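/- **Setting.** Let $H$ be a Hopf $*$-algebra over $\mathbb{C}$ (so $\Delta(h^*)=h_{(1)}^*\otimes h_{(2)}^*$, $\varepsilon(h^*)=\overline{\varepsilon(h)}$, $(S\circ *)^2=\mathrm{id}$) with invertible antipode $S$, and let $B$ be a unital $*$-algebra over $\mathbb{C}$ which is an algebra in the category $\mathcal{M}^H_H$ of right crossed (Drinfeld–Yetter) modules: $B$ is a right $H$-module algebra by $\triangleleft$ and a right $H$-comodule algebra by $b\mapsto b_{(0)}\otimes b_{(1)}$, with $$(a\triangleleft h_{(2)})_{(0)}\otimes h_{(1)}(a\triangleleft h_{(2)})_{(1)}=a_{(0)}\triangleleft h_{(1)}\otimes a_{(1)}h_{(2)}.$$ Suppose that $B$ is braided-commutative, $b_{(0)}(a\triangleleft b_{(1)})=ab$, and that the action and coaction are unitary, $(a\triangleleft h)^*=a^*\triangleleft S^{-1}(h^*)$ and $(a^*)_{(0)}\otimes (a^*)_{(1)}=(a_{(0)})^*\otimes (a_{(1)})^*$. Let $\mathcal{L}=B\# H^{op}$ be the vector space $B\otimes H$ with $$(a\otimes h)(b\otimes g)=a(b\triangleleft h_{(1)})\otimes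 g h_{(2)},\quad s_L(a)=a\otimes 1,\quad t_L(a)=a_{(0)}\otimes a_{(1)},$$ $$\varepsilon_L(a\otimes h)=a\,\varepsilon(h),\quad \Delta_L(a\otimes h)=(a\otimes h_{(1)})\otimes_B(1\otimes h_{(2)}),$$ and let $\mathcal{R}=H\# B$ be the vector space $H\otimes B$ with $$(h\otimes a)(g\otimes b)=hg_{(1)}\otimes (a\triangleleft g_{(2)})b,\quad s_R(a)=1\otimes a,\quad t_R(a)=S^{-1}(a_{(1)})\otimes a_{(0)},$$ $$\varepsilon_R(h\otimes a)=\varepsilon(h)a,\quad \Delta_R(h\otimes a)=(h_{(1)}\otimes 1)\otimes_B(h_{(2)}\otimes a).$$ **Definitions.** Left and right $B$-bialgebroids are meant in the usual (Takeuchi) sense, for the $B$-bimodule structures $a.X.b=s_L(a)t_L(b)X$ on $\mathcal{L}$ and $a.X.b=Xt_R(a)s_R(b)$ on $\mathcal{R}$. A pair $(\mathcal{L},\mathcal{R})$ of a left and a right $B$-bialgebroid is a *$*$-Hopf algebroid pair*, with respect to maps $\circledast,\Phi:\mathcal{L}\to\mathcal{R}$, if * ($*$-related) $\circledast$ is an invertible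 antilinear anti-algebra map with $s_L(a)^\circledast=s_R(a^*)$, $t_L(a)^\circledast=t_R(a^*)$, $\Delta_R(X^\circledast)=\mathrm{flip}(\circledast\otimes\circledast)\Delta_L(X)$ and $\varepsilon_R(X^\circledast)=\varepsilon_L(X)^*$; * (reflexive) $\Phi$ is an invertible linear unital anti-algebra map and coalgebra map, i.e. $\Delta_R\circ\Phi=(\Phi\otimes\Phi)\Delta_L$ and $\varepsilon_R\circ\Phi=\varepsilon_L$, with $\Phi\circ s_L=t_R$ and $\Phi\circ t_L=s_R$; * $\Phi^{-1}\circ\circledast=\circledast^{-1}\circ\Phi$; * $\mathcal{L}$ is a left and anti-left Hopf algebroid, i.e. the maps $X\otimes Y\mapsto X_{(1)}\otimes_B X_{(2)}Y$ (on $\mathcal{L}\otimes\mathcal{L}$ modulo $Xt_L(a)\otimes Y=X\otimes t_L(a)Y$) and $X\otimes Y\mapsto Y_{(1)}X\otimes_B Y_{(2)}$ (on $\mathcal{L}\otimes\mathcal{L}$ modulo $s_L(a)X\otimes Y=X\otimes Ys_L(a)$) to $\mathcal{L}\otimes_B\mathcal{L}$ are invertible; and, equivalently in the presence of $\Phi$,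 $\mathcal{R}$ is a right and anti-right Hopf algebroid, i.e. the maps $X\otimes Y\mapsto XY_{[1]}\otimes_B Y_{[2]}$ (on $\mathcal{R}\otimes\mathcal{R}$ modulo $Xt_R(a)\otimes Y=X\otimes t_R(a)Y$) and $X\otimes Y\mapsto X_{[1]}\otimes_B YX_{[2]}$ (on $\mathcal{R}\otimes\mathcal{R}$ modulo $s_R(a)X\otimes Y=X\otimes Ys_R(a)$) to $\mathcal{R}\otimes_B\mathcal{R}$ are invertible, where $\Delta_R(X)=X_{[1]}\otimes_B X_{[2]}$. **Theorem.** With the structure above, $B\# H^{op}$ is a left $B$-bialgebroid, $H\# B$ is a right $B$-bialgebroid, and $(B\# H^{op},H\# B)$ is a $*$-Hopf algebroid pair with $$(a\otimes h)^\circledast=S^{-1}(h^*)\otimes a^*,\quad \Phi(a\otimes h)=h\,S^{-1}(a_{(1)})\otimes a_{(0)},\quad \Phi^{-1}(h\otimes a)=a_{(0)}\otimes h\,a_{(1)}.$$ -/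

import Mathlib

open scoped TensorProduct

noncomputable section

namespace HopfAlgebroids

/-! ## Balanced tensor products over a noncommutative base -/

section Balanced

variable {k A L : Type*} [CommRing k] [AddCommGroup L] [Module k L]

/-- The relations `p a x ⊗ y = x ⊗ q a y`. -/
def balancedRel (k : Type*) {A L : Type*} [CommRing k] [AddCommGroup L] [Module k L]
    (p q : A → L → L) : Submodule k (L ⊗[k] L) :=
  Submodule.span k {z | ∃ (a : A) (x y : L), z = p a x ⊗ₜ[k] y - x ⊗ₜ[k] q a y}

/-- The balanced tensor product of `L` with itself: the quotient of `L ⊗[k] L` by the relations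
`p a x ⊗ y = x ⊗ q a y`. -/
abbrev BalancedTensor (k : Type*) {A L : Type*} [CommRing k] [AddCommGroup L] [Module k L]
    (p q : A → L → L) : Type _ :=
  (L ⊗[k] L) ⧸ balancedRel k p q

/-- The relations `p a x ⊗ y ⊗ z = x ⊗ q a y ⊗ z` and `x ⊗ p a y ⊗ z = x ⊗ y ⊗ q a z`. -/
def balancedRel₃ (k : Type*) {A L : Type*} [CommRing k] [AddCommGroup L] [Module k L]
    (p q : A → L → L) : Submodule k (L ⊗[k] (L ⊗[k] L)) :=
  Submodule.span k
    ({z | ∃ (a : A) (x y w : L),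
        z = p a x ⊗ₜ[k] (y ⊗ₜ[k] w) - x ⊗ₜ[k] (q a y ⊗ₜ[k] w)} ∪
     {z | ∃ (a : A) (x y w : L),
        z = x ⊗ₜ[k] (p a y ⊗ₜ[k] w) - x ⊗ₜ[k] (y ⊗ₜ[k] q a w)})

/-- The threefold balanced tensor product of `L` with itself. -/
abbrev BalancedTensor₃ (k : Type*) {A L : Type*} [CommRing k] [AddCommGroup L] [Module k L]
    (p q : A → L → L) : Type _ :=
  (L ⊗[k] (L ⊗[k] L)) ⧸ balancedRel₃ k p q

/-- The canonical map from (balanced square of `L`) `⊗[k] L` to the balanced cube. -/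
def joinLeft (p q : A → L → L) :
    BalancedTensor k p q ⊗[k] L →ₗ[k] BalancedTensor₃ k p q :=
  TensorProduct.lift <|
    (balancedRel k p q).liftQ
      (TensorProduct.curry
        ((balancedRel₃ k p q).mkQ ∘ₗ (TensorProduct.assoc k L L L).toLinearMap))
      (by
        refine Submodule.span_le.2 ?_
        rintro z ⟨a, x, y, rfl⟩
        refine LinearMap.mem_ker.2 (LinearMap.ext fun w => ?_)
        simp only [map_sub, LinearMap.sub_apply, TensorProduct.curry_apply,
          LinearMap.comp_apply, LinearEquiv.coe_coe, TensorProduct.assoc_tmul,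
          LinearMap.zero_apply]
        rw [← map_sub, Submodule.mkQ_apply, Submodule.Quotient.mk_eq_zero]
        exact Submodule.subset_span (Or.inl ⟨a, x, y, w, rfl⟩))

/-- The canonical map from `L ⊗[k]` (balanced square of `L`) to the balanced cube. -/
def joinRight (p q : A → L → L) :
    L ⊗[k] BalancedTensor k p q →ₗ[k] BalancedTensor₃ k p q :=
  TensorProduct.lift <| LinearMap.flip <|
    (balancedRel k p q).liftQ
      (TensorProduct.curry
        ((balancedRel₃ k p q).mkQ ∘ₗ (TensorProduct.comm k (L ⊗[k] L) L).toLinearMap))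
      (by
        refine Submodule.span_le.2 ?_
        rintro z ⟨a, x, y, rfl⟩
        refine LinearMap.mem_ker.2 (LinearMap.ext fun w => ?_)
        simp only [map_sub, LinearMap.sub_apply, TensorProduct.curry_apply,
          LinearMap.comp_apply, LinearEquiv.coe_coe, TensorProduct.comm_tmul,
          LinearMap.zero_apply]
        rw [← map_sub, Submodule.mkQ_apply, Submodule.Quotient.mk_eq_zero]
        exact Submodule.subset_span (Or.inr ⟨a, w, x, y, rfl⟩))

end Balanced

/-! ## Left bialgebroids

Identities between elements of balanced tensor products are stated on arbitrary representatives
`u` in `L ⊗[k] L` (the sum `X₁ ⊗ X₂` of the Sweedler notation) of the coproduct of `X`. The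
operations applied to `u` below do not depend on the representative (for the product of two
coproducts this is because their values lie in the Takeuchi product). -/

section Left

/-- The structure maps of a left bialgebroid `L` over `A`. The coproduct takes values in
`L ⊗_A L`, where `t(a) X ⊗ Y = X ⊗ s(a) Y`, i.e. `L` is the `A`-bimodule `a.X.b = s(a) t(b) X`. -/
structure LeftBialgebroidData (k A L : Type*) [CommRing k] [Ring A] [Algebra k A]
    [Ring L] [Algebra k L] where
  source : A →ₗ[k] L
  target : A →ₗ[k] L
  comul : L →ₗ[k]
    BalancedTensor k (fun a x => target a * x) (fun a (y : L) => source a * y)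
  counit : L →ₗ[k] A

variable {k A L : Type*} [CommRing k] [Ring A] [Algebra k A] [Ring L] [Algebra k L]

namespace LeftBialgebroidData

variable (D : LeftBialgebroidData k A L)

/-- `L ⊗_A L`. -/
abbrev Square : Type _ :=
  BalancedTensor k (fun (a : A) (x : L) => D.target a * x) (fun a y => D.source a * y)

/-- The projection of `L ⊗[k] L` onto `L ⊗_A L`. -/
abbrev proj : L ⊗[k] L →ₗ[k] D.Square := Submodule.mkQ _

/-- `L ⊗_{A^op} L`, with `X t(a) ⊗ Y = X ⊗ t(a) Y`. -/
abbrev OpSquare : Type _ :=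
  BalancedTensor k (fun (a : A) (x : L) => x * D.target a) (fun a y => D.target a * y)

/-- `L ⊗^A L`, with `s(a) X ⊗ Y = X ⊗ Y s(a)`. -/
abbrev UpperSquare : Type _ :=
  BalancedTensor k (fun (a : A) (x : L) => D.source a * x) (fun a y => y * D.source a)

/-- The axioms of a left bialgebroid. -/
structure IsLeftBialgebroid : Prop where
  source_one : D.source 1 = 1
  source_mul : ∀ a b, D.source (a * b) = D.source a * D.source b
  target_one : D.target 1 = 1
  target_mul : ∀ a b, D.target (a * b) = D.target b * D.target a
  source_target_comm : ∀ a b, D.source a * D.target b = D.target b * D.source a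
  /-- The coproduct and the counit are maps of `A`-bimodules. -/
  comul_source_mul : ∀ a X u, D.proj u = D.comul X →
    D.comul (D.source a * X) = D.proj ((D.source a ⊗ₜ 1) * u)
  comul_target_mul : ∀ a X u, D.proj u = D.comul X →
    D.comul (D.target a * X) = D.proj ((1 ⊗ₜ D.target a) * u)
  counit_source_mul : ∀ a X, D.counit (D.source a * X) = a * D.counit X
  counit_target_mul : ∀ a X, D.counit (D.target a * X) = D.counit X * a
  /-- Coassociativity in `L ⊗_A L ⊗_A L`. -/
  coassoc : ∀ X u, D.proj u = D.comul X →
    joinLeft (k := k) _ _ (D.comul.rTensor L u) = joinRight (k := k) _ _ (D.comul.lTensor L u)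
  /-- `s(ε(X₁)) X₂ = X`. -/
  counit_comul : ∀ X u, D.proj u = D.comul X →
    LinearMap.mul' k L ((D.source ∘ₗ D.counit).rTensor L u) = X
  /-- `t(ε(X₂)) X₁ = X`. -/
  comul_counit : ∀ X u, D.proj u = D.comul X →
    LinearMap.mul' k L
      ((D.target ∘ₗ D.counit).rTensor L (TensorProduct.comm k L L u)) = X
  /-- The coproduct has its image in the Takeuchi product. -/
  takeuchi : ∀ a X u, D.proj u = D.comul X →
    D.proj (u * (D.target a ⊗ₜ 1)) = D.proj (u * (1 ⊗ₜ D.source a))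
  /-- The coproduct is an algebra map to the Takeuchi product. -/
  comul_one : D.comul 1 = D.proj (1 ⊗ₜ 1)
  comul_mul : ∀ X Y u v, D.proj u = D.comul X → D.proj v = D.comul Y →
    D.comul (X * Y) = D.proj (u * v)
  counit_one : D.counit 1 = 1
  counit_mul_source : ∀ X Y, D.counit (X * Y) = D.counit (X * D.source (D.counit Y))
  counit_mul_target : ∀ X Y, D.counit (X * Y) = D.counit (X * D.target (D.counit Y))

/-- Left Hopf: the map `X ⊗ Y ↦ X₁ ⊗ X₂ Y` from `L ⊗_{A^op} L` to `L ⊗_A L` is (well defined and)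
invertible. -/
def IsLeftHopf : Prop :=
  ∃ e : D.OpSquare ≃ₗ[k] D.Square, ∀ X Y u, D.proj u = D.comul X →
    e (Submodule.Quotient.mk (X ⊗ₜ[k] Y)) = D.proj (u * (1 ⊗ₜ Y))

/-- Anti-left Hopf: the map `X ⊗ Y ↦ Y₁ X ⊗ Y₂` from `L ⊗^A L` to `L ⊗_A L` is (well defined and)
invertible. -/
def IsAntiLeftHopf : Prop :=
  ∃ e : D.UpperSquare ≃ₗ[k] D.Square, ∀ X Y u, D.proj u = D.comul Y →
    e (Submodule.Quotient.mk (X ⊗ₜ[k] Y)) = D.proj (u * (X ⊗ₜ 1))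

end LeftBialgebroidData

end Left

/-! ## Right bialgebroids -/

section Right

/-- The structure maps of a right bialgebroid `R` over `A`. The coproduct takes values in
`R ⊗_A R`, where `X s(a) ⊗ Y = X ⊗ Y t(a)`, i.e. `R` is the `A`-bimodule `a.X.b = X t(a) s(b)`. -/
structure RightBialgebroidData (k A R : Type*) [CommRing k] [Ring A] [Algebra k A]
    [Ring R] [Algebra k R] where
  source : A →ₗ[k] R
  target : A →ₗ[k] R
  comul : R →ₗ[k]
    BalancedTensor k (fun a x => x * source a) (fun a (y : R) => y * target a)
  counit : R →ₗ[k] A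

variable {k A R : Type*} [CommRing k] [Ring A] [Algebra k A] [Ring R] [Algebra k R]

namespace RightBialgebroidData

variable (D : RightBialgebroidData k A R)

/-- `R ⊗_A R`. -/
abbrev Square : Type _ :=
  BalancedTensor k (fun (a : A) (x : R) => x * D.source a) (fun a y => y * D.target a)

/-- The projection of `R ⊗[k] R` onto `R ⊗_A R`. -/
abbrev proj : R ⊗[k] R →ₗ[k] D.Square := Submodule.mkQ _

/-- `R ⊗_{A^op} R`, with `X t(a) ⊗ Y = X ⊗ t(a) Y`. -/
abbrev OpSquare : Type _ :=
  BalancedTensor k (fun (a : A) (x : R) => x * D.target a) (fun a y => D.target a * y)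

/-- `R ⊗^A R`, with `s(a) X ⊗ Y = X ⊗ Y s(a)`. -/
abbrev UpperSquare : Type _ :=
  BalancedTensor k (fun (a : A) (x : R) => D.source a * x) (fun a y => y * D.source a)

/-- The axioms of a right bialgebroid. -/
structure IsRightBialgebroid : Prop where
  source_one : D.source 1 = 1
  source_mul : ∀ a b, D.source (a * b) = D.source a * D.source b
  target_one : D.target 1 = 1
  target_mul : ∀ a b, D.target (a * b) = D.target b * D.target a
  source_target_comm : ∀ a b, D.source a * D.target b = D.target b * D.source a
  /-- The coproduct and the counit are maps of `A`-bimodules. -/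
  comul_mul_target : ∀ a X u, D.proj u = D.comul X →
    D.comul (X * D.target a) = D.proj (u * (D.target a ⊗ₜ 1))
  comul_mul_source : ∀ a X u, D.proj u = D.comul X →
    D.comul (X * D.source a) = D.proj (u * (1 ⊗ₜ D.source a))
  counit_mul_target : ∀ a X, D.counit (X * D.target a) = a * D.counit X
  counit_mul_source : ∀ a X, D.counit (X * D.source a) = D.counit X * a
  /-- Coassociativity in `R ⊗_A R ⊗_A R`. -/
  coassoc : ∀ X u, D.proj u = D.comul X →
    joinLeft (k := k) _ _ (D.comul.rTensor R u) = joinRight (k := k) _ _ (D.comul.lTensor R u)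
  /-- `X₂ t(ε(X₁)) = X`. -/
  counit_comul : ∀ X u, D.proj u = D.comul X →
    LinearMap.mul' k R
      ((D.target ∘ₗ D.counit).lTensor R (TensorProduct.comm k R R u)) = X
  /-- `X₁ s(ε(X₂)) = X`. -/
  comul_counit : ∀ X u, D.proj u = D.comul X →
    LinearMap.mul' k R ((D.source ∘ₗ D.counit).lTensor R u) = X
  /-- The coproduct has its image in the Takeuchi product. -/
  takeuchi : ∀ a X u, D.proj u = D.comul X →
    D.proj ((D.source a ⊗ₜ 1) * u) = D.proj ((1 ⊗ₜ D.target a) * u)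
  /-- The coproduct is an algebra map to the Takeuchi product. -/
  comul_one : D.comul 1 = D.proj (1 ⊗ₜ 1)
  comul_mul : ∀ X Y u v, D.proj u = D.comul X → D.proj v = D.comul Y →
    D.comul (X * Y) = D.proj (u * v)
  counit_one : D.counit 1 = 1
  counit_source_mul : ∀ X Y, D.counit (X * Y) = D.counit (D.source (D.counit X) * Y)
  counit_target_mul : ∀ X Y, D.counit (X * Y) = D.counit (D.target (D.counit X) * Y)

/-- Right Hopf: the map `X ⊗ Y ↦ X Y₁ ⊗ Y₂` from `R ⊗_{A^op} R` to `R ⊗_A R` is (well defined and)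
invertible. -/
def IsRightHopf : Prop :=
  ∃ e : D.OpSquare ≃ₗ[k] D.Square, ∀ X Y u, D.proj u = D.comul Y →
    e (Submodule.Quotient.mk (X ⊗ₜ[k] Y)) = D.proj ((X ⊗ₜ 1) * u)

/-- Anti-right Hopf: the map `X ⊗ Y ↦ X₁ ⊗ Y X₂` from `R ⊗^A R` to `R ⊗_A R` is (well defined and)
invertible. -/
def IsAntiRightHopf : Prop :=
  ∃ e : D.UpperSquare ≃ₗ[k] D.Square, ∀ X Y u, D.proj u = D.comul X →
    e (Submodule.Quotient.mk (X ⊗ₜ[k] Y)) = D.proj ((1 ⊗ₜ Y) * u)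

end RightBialgebroidData

end Right

/-! ## Pairs -/

section Pairs

/-- Reflexive pairs: `Φ` is an invertible linear anti-algebra and coalgebra map exchanging source
and target maps. -/
structure IsReflexive {k A L R : Type*} [CommRing k] [Ring A] [Algebra k A]
    [Ring L] [Algebra k L] [Ring R] [Algebra k R]
    (DL : LeftBialgebroidData k A L) (DR : RightBialgebroidData k A R)
    (Φ : L ≃ₗ[k] R) : Prop where
  map_one : Φ 1 = 1
  map_mul : ∀ X Y, Φ (X * Y) = Φ Y * Φ X
  map_source : ∀ a, Φ (DL.source a) = DR.target a
  map_target : ∀ a, Φ (DL.target a) = DR.source a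
  map_comul : ∀ X u, DL.proj u = DL.comul X →
    DR.comul (Φ X) = DR.proj (TensorProduct.map Φ.toLinearMap Φ.toLinearMap u)
  map_counit : ∀ X, DR.counit (Φ X) = DL.counit X

/-- `*`-related left and right bialgebroids over a `*`-algebra `A`: `σ` is an invertible antilinear
anti-algebra and anti-coalgebra map, compatible with sources, targets and counits. -/
structure IsStarRelated {A L R : Type*} [Ring A] [Algebra ℂ A] [StarRing A] [StarModule ℂ A]
    [Ring L] [Algebra ℂ L] [Ring R] [Algebra ℂ R]
    (DL : LeftBialgebroidData ℂ A L) (DR : RightBialgebroidData ℂ A R)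
    (σ : L ≃ₛₗ[starRingEnd ℂ] R) : Prop where
  map_one : σ 1 = 1
  map_mul : ∀ X Y, σ (X * Y) = σ Y * σ X
  map_source : ∀ a, σ (DL.source a) = DR.source (star a)
  map_target : ∀ a, σ (DL.target a) = DR.target (star a)
  map_comul : ∀ X u, DL.proj u = DL.comul X →
    DR.comul (σ X) =
      DR.proj (TensorProduct.comm ℂ R R (TensorProduct.map σ.toLinearMap σ.toLinearMap u))
  map_counit : ∀ X, DR.counit (σ X) = star (DL.counit X)

/-- A `*`-bialgebroid pair over a `*`-algebra `A`. -/
structure IsStarBialgebroidPair {A L R : Type*} [Ring A] [Algebra ℂ A] [StarRing A]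
    [StarModule ℂ A] [Ring L] [Algebra ℂ L] [Ring R] [Algebra ℂ R]
    (DL : LeftBialgebroidData ℂ A L) (DR : RightBialgebroidData ℂ A R)
    (σ : L ≃ₛₗ[starRingEnd ℂ] R) (Φ : L ≃ₗ[ℂ] R) : Prop where
  isLeftBialgebroid : DL.IsLeftBialgebroid
  isRightBialgebroid : DR.IsRightBialgebroid
  isStarRelated : IsStarRelated DL DR σ
  isReflexive : IsReflexive DL DR Φ
  compatible : ∀ X, Φ.symm (σ X) = σ.symm (Φ X)

/-- A `*`-Hopf algebroid pair: a `*`-bialgebroid pair whose left member is left and anti-left Hopf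
and whose right member is right and anti-right Hopf (for a reflexive pair, either of these two
conditions implies the other; both are recorded here). -/
structure IsStarHopfAlgebroidPair {A L R : Type*} [Ring A] [Algebra ℂ A] [StarRing A]
    [StarModule ℂ A] [Ring L] [Algebra ℂ L] [Ring R] [Algebra ℂ R]
    (DL : LeftBialgebroidData ℂ A L) (DR : RightBialgebroidData ℂ A R)
    (σ : L ≃ₛₗ[starRingEnd ℂ] R) (Φ : L ≃ₗ[ℂ] R) : Prop
    extends IsStarBialgebroidPair DL DR σ Φ where
  isLeftHopf : DL.IsLeftHopf
  isAntiLeftHopf : DL.IsAntiLeftHopf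
  isRightHopf : DR.IsRightHopf
  isAntiRightHopf : DR.IsAntiRightHopf

end Pairs

/-! ## Algebras in the category of right crossed modules -/

/-- The inverse of a bijective antipode. -/
def antipodeInv {k H : Type*} [CommRing k] [Ring H] [HopfAlgebra k H]
    (hS : Function.Bijective (HopfAlgebra.antipode k (A := H))) : H →ₗ[k] H :=
  (LinearEquiv.ofBijective (HopfAlgebra.antipode k (A := H)) hS).symm.toLinearMap

/-- A Hopf `*`-algebra. -/
structure IsHopfStarAlgebra (H : Type*) [Ring H] [HopfAlgebra ℂ H] [StarRing H]
    [StarModule ℂ H] : Prop where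
  comul_star : ∀ h : H, Coalgebra.comul (R := ℂ) (star h) = star (Coalgebra.comul (R := ℂ) h)
  counit_star : ∀ h : H, Coalgebra.counit (R := ℂ) (star h) = star (Coalgebra.counit (R := ℂ) h)
  antipode_star : ∀ h : H,
    HopfAlgebra.antipode ℂ (star (HopfAlgebra.antipode ℂ (star h))) = h

/-- The structure of an algebra in the category of right `H`-crossed (Drinfeld-Yetter) modules on
an algebra `B`: a right action `act b h`, written `b ◁ h`, making `B` an `H`-module algebra, and a
right coaction `b ↦ b₀ ⊗ b₁` making `B` an `H`-comodule algebra, subject to the crossed module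
condition. -/
structure CrossedModuleAlgebra (k H B : Type*) [CommRing k] [Ring H] [HopfAlgebra k H]
    [Ring B] [Algebra k B] where
  act : B →ₗ[k] H →ₗ[k] B
  act_one : ∀ b, act b 1 = b
  act_mul : ∀ b h g, act b (h * g) = act (act b h) g
  /-- `1 ◁ h = ε(h) 1`. -/
  one_act : ∀ h, act 1 h = Coalgebra.counit (R := k) h • (1 : B)
  /-- `(a b) ◁ h = (a ◁ h₁) (b ◁ h₂)`. -/
  mul_act : ∀ a b h, act (a * b) h =
    LinearMap.mul' k B (TensorProduct.map (act a) (act b) (Coalgebra.comul (R := k) h))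
  coact : B →ₐ[k] B ⊗[k] H
  coact_coassoc : ∀ b,
    TensorProduct.assoc k B H H (coact.toLinearMap.rTensor H (coact b)) =
      (Coalgebra.comul (R := k) (A := H)).lTensor B (coact b)
  coact_counit : ∀ b,
    TensorProduct.rid k B ((Coalgebra.counit (R := k) (A := H)).lTensor B (coact b)) = b
  /-- `(a ◁ h₂)₀ ⊗ h₁ (a ◁ h₂)₁ = a₀ ◁ h₁ ⊗ a₁ h₂`. The left hand side is the image of `h₁ ⊗ h₂`
  under the linear map that sends `x ⊗ y` to `(1 ⊗ x) * coact (a ◁ y)`. -/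
  crossed : ∀ a h,
    LinearMap.mul' k (B ⊗[k] H)
        (TensorProduct.map (TensorProduct.mk k B H 1) (coact.toLinearMap ∘ₗ act a)
          (Coalgebra.comul (R := k) h)) =
      TensorProduct.map₂ act (LinearMap.mul k H) (coact a) (Coalgebra.comul (R := k) h)

namespace CrossedModuleAlgebra

section General

variable {k H B : Type*} [CommRing k] [Ring H] [HopfAlgebra k H] [Ring B] [Algebra k B]
variable (C : CrossedModuleAlgebra k H B)

/-- Braided commutativity: `b₀ (a ◁ b₁) = a b`. -/
def IsBraidedCommutative : Prop :=
  ∀ a b : B, LinearMap.mul' k B ((C.act a).lTensor B (C.coact b)) = a * b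

/-! ### The smash products -/

/-- The underlying space `B ⊗ H` of the smash product `B # H^op`. -/
def LeftSmash (_C : CrossedModuleAlgebra k H B) : Type _ := B ⊗[k] H

/-- The underlying space `H ⊗ B` of the smash product `H # B`. -/
def RightSmash (_C : CrossedModuleAlgebra k H B) : Type _ := H ⊗[k] B

instance : AddCommGroup C.LeftSmash := inferInstanceAs (AddCommGroup (B ⊗[k] H))
instance : Module k C.LeftSmash := inferInstanceAs (Module k (B ⊗[k] H))
instance : AddCommGroup C.RightSmash := inferInstanceAs (AddCommGroup (H ⊗[k] B))
instance : Module k C.RightSmash := inferInstanceAs (Module k (H ⊗[k] B))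

/-- The identity map from `B ⊗ H` to `B # H^op`. -/
def toLeft : B ⊗[k] H ≃ₗ[k] C.LeftSmash := LinearEquiv.refl k (B ⊗[k] H)

/-- The identity map from `H ⊗ B` to `H # B`. -/
def toRight : H ⊗[k] B ≃ₗ[k] C.RightSmash := LinearEquiv.refl k (H ⊗[k] B)

/-- The product `(a ⊗ h) (b ⊗ g) = a (b ◁ h₁) ⊗ g h₂` on `B ⊗ H`. -/
def leftMul : B ⊗[k] H →ₗ[k] B ⊗[k] H →ₗ[k] B ⊗[k] H :=
  TensorProduct.lift <| LinearMap.mk₂ k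
    (fun a h => TensorProduct.lift <| LinearMap.mk₂ k
      (fun b g => TensorProduct.map (LinearMap.mul k B a ∘ₗ C.act b) (LinearMap.mul k H g)
        (Coalgebra.comul (R := k) h))
      (fun b b' g => by simp [LinearMap.comp_add, TensorProduct.map_add_left])
      (fun c b g => by simp [LinearMap.comp_smul, TensorProduct.map_smul_left])
      (fun b g g' => by simp [TensorProduct.map_add_right])
      (fun c b g => by simp [TensorProduct.map_smul_right]))
    (fun a a' h => TensorProduct.ext' fun b g => by
      simp [LinearMap.add_comp, TensorProduct.map_add_left])
    (fun c a h => TensorProduct.ext' fun b g => by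
      simp [LinearMap.smul_comp, TensorProduct.map_smul_left])
    (fun a h h' => TensorProduct.ext' fun b g => by simp)
    (fun c a h => TensorProduct.ext' fun b g => by simp)

/-- The product `(h ⊗ a) (g ⊗ b) = h g₁ ⊗ (a ◁ g₂) b` on `H ⊗ B`. -/
def rightMul : H ⊗[k] B →ₗ[k] H ⊗[k] B →ₗ[k] H ⊗[k] B :=
  TensorProduct.lift <| LinearMap.mk₂ k
    (fun h a => TensorProduct.lift <| LinearMap.mk₂ k
      (fun g b => TensorProduct.map (LinearMap.mul k H h) ((LinearMap.mul k B).flip b ∘ₗ C.act a)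
        (Coalgebra.comul (R := k) g))
      (fun g g' b => by simp)
      (fun c g b => by simp)
      (fun g b b' => by simp [LinearMap.add_comp, TensorProduct.map_add_right])
      (fun c g b => by simp [LinearMap.smul_comp, TensorProduct.map_smul_right]))
    (fun h h' a => TensorProduct.ext' fun g b => by simp [TensorProduct.map_add_left])
    (fun c h a => TensorProduct.ext' fun g b => by simp [TensorProduct.map_smul_left])
    (fun h a a' => TensorProduct.ext' fun g b => by
      simp [LinearMap.comp_add, TensorProduct.map_add_right])
    (fun c h a => TensorProduct.ext' fun g b => by
      simp [LinearMap.comp_smul, TensorProduct.map_smul_right])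

theorem leftMul_tmul (a b : B) (h g : H) :
    C.leftMul (a ⊗ₜ h) (b ⊗ₜ g) =
      TensorProduct.map (LinearMap.mul k B a ∘ₗ C.act b) (LinearMap.mul k H g)
        (Coalgebra.comul (R := k) h) := rfl

theorem rightMul_tmul (a b : B) (h g : H) :
    C.rightMul (h ⊗ₜ a) (g ⊗ₜ b) =
      TensorProduct.map (LinearMap.mul k H h) ((LinearMap.mul k B).flip b ∘ₗ C.act a)
        (Coalgebra.comul (R := k) g) := rfl

theorem leftMul_one (x : B ⊗[k] H) : C.leftMul x (1 ⊗ₜ 1) = x := by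
  induction x with
  | zero => simp
  | add x y hx hy => simp [hx, hy]
  | tmul a h =>
    rw [leftMul_tmul]
    have key : ∀ z : H ⊗[k] H,
        TensorProduct.map (LinearMap.mul k B a ∘ₗ C.act 1) (LinearMap.mul k H 1) z =
          a ⊗ₜ[k] TensorProduct.lid k H ((Coalgebra.counit (R := k) (A := H)).rTensor H z) := by
      intro z
      induction z with
      | zero => simp
      | add x y hx hy => simp only [map_add, hx, hy, TensorProduct.tmul_add]
      | tmul x y => simp [C.one_act, TensorProduct.smul_tmul]
    rw [key]
    simp

theorem one_leftMul (x : B ⊗[k] H) : C.leftMul (1 ⊗ₜ 1) x = x := by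
  induction x with
  | zero => simp
  | add x y hx hy => simp [hx, hy]
  | tmul a h => simp [leftMul_tmul, C.act_one, Algebra.TensorProduct.one_def]

theorem rightMul_one (x : H ⊗[k] B) : C.rightMul x (1 ⊗ₜ 1) = x := by
  induction x with
  | zero => simp
  | add x y hx hy => simp [hx, hy]
  | tmul h a => simp [rightMul_tmul, C.act_one, Algebra.TensorProduct.one_def]

theorem one_rightMul (x : H ⊗[k] B) : C.rightMul (1 ⊗ₜ 1) x = x := by
  induction x with
  | zero => simp
  | add x y hx hy => simp [hx, hy]
  | tmul h a =>
    rw [rightMul_tmul]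
    have key : ∀ z : H ⊗[k] H,
        TensorProduct.map (LinearMap.mul k H 1) ((LinearMap.mul k B).flip a ∘ₗ C.act 1) z =
          TensorProduct.rid k H ((Coalgebra.counit (R := k) (A := H)).lTensor H z) ⊗ₜ[k] a := by
      intro z
      induction z with
      | zero => simp
      | add x y hx hy => simp only [map_add, hx, hy, TensorProduct.add_tmul]
      | tmul x y => simp [C.one_act, TensorProduct.smul_tmul]
    rw [key]
    simp

theorem leftMul_assoc (x y z : B ⊗[k] H) :
    C.leftMul (C.leftMul x y) z = C.leftMul x (C.leftMul y z) := by
  induction x with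
  | zero => simp
  | add x x' hx hx' => simp only [map_add, LinearMap.add_apply, hx, hx']
  | tmul a h =>
  induction y with
  | zero => simp
  | add x x' hx hx' => simp only [map_add, LinearMap.add_apply, hx, hx']
  | tmul b g =>
  induction z with
  | zero => simp
  | add x x' hx hx' => simp only [map_add, hx, hx']
  | tmul c f =>
  rw [leftMul_tmul, leftMul_tmul]
  -- `G w (u ⊗ (v ⊗ v')) = a (b ◁ u) (c ◁ w₁ v) ⊗ f w₂ v'`
  let G (w : H ⊗[k] H) : H ⊗[k] (H ⊗[k] H) →ₗ[k] B ⊗[k] H :=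
    TensorProduct.lift ((LinearMap.mk₂ k (fun (u : H) (t : H ⊗[k] H) =>
      TensorProduct.map (LinearMap.mul k B (a * C.act b u) ∘ₗ C.act c) (LinearMap.mul k H f)
        (w * t))
      (fun u u' t => by
        simp [mul_add, LinearMap.add_comp, TensorProduct.map_add_left])
      (fun r u t => by simp [LinearMap.smul_comp, TensorProduct.map_smul_left])
      (fun u t t' => by simp [mul_add])
      (fun r u t => by simp)))
  have h1 : ∀ s : H ⊗[k] H,
      C.leftMul (TensorProduct.map (LinearMap.mul k B a ∘ₗ C.act b) (LinearMap.mul k H g) s)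
        (c ⊗ₜ f) = G (Coalgebra.comul (R := k) g)
          ((Coalgebra.comul (R := k) (A := H)).lTensor H s) := by
    intro s
    induction s with
    | zero => simp
    | add x y hx hy => simp only [map_add, LinearMap.add_apply, hx, hy]
    | tmul x y => simp [leftMul_tmul, G]
  have hG0 : G 0 = 0 := TensorProduct.ext' fun u t => by simp [G]
  have hGadd : ∀ w w', G (w + w') = G w + G w' := fun w w' =>
    TensorProduct.ext' fun u t => by simp [G, add_mul]
  have h3 : ∀ (p q : H) (r : H ⊗[k] H),
      (a * LinearMap.mul' k B (TensorProduct.map (C.act b) (C.act (C.act c p)) r)) ⊗ₜ[k]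
          (f * q) = G (p ⊗ₜ 1) (TensorProduct.assoc k H H H (r ⊗ₜ q)) := by
    intro p q r
    induction r with
    | zero => simp
    | add x y hx hy => simp only [map_add, mul_add, TensorProduct.add_tmul, hx, hy]
    | tmul x y => simp [G, C.act_mul, mul_assoc]
  have h4 : ∀ (p q : H) (s : H ⊗[k] H),
      TensorProduct.map (LinearMap.mul k B a ∘ₗ C.act (b * C.act c p)) (LinearMap.mul k H (f * q))
          s = G (p ⊗ₜ q) (TensorProduct.assoc k H H H
            ((Coalgebra.comul (R := k) (A := H)).rTensor H s)) := by
    intro p q s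
    have hG1 : ∀ (r : H ⊗[k] H) (y : H),
        G (p ⊗ₜ q) (TensorProduct.assoc k H H H (r ⊗ₜ y)) =
          G (p ⊗ₜ 1) (TensorProduct.assoc k H H H (r ⊗ₜ (q * y))) := by
      intro r y
      induction r with
      | zero => simp
      | add x y hx hy => simp only [map_add, TensorProduct.add_tmul, hx, hy]
      | tmul x y => simp [G]
    induction s with
    | zero => simp
    | add x y hx hy => simp only [map_add, hx, hy]
    | tmul x y =>
      rw [LinearMap.rTensor_tmul, hG1, ← h3]
      simp [C.mul_act, mul_assoc]
  have h2 : ∀ w : H ⊗[k] H,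
      C.leftMul (a ⊗ₜ h)
          (TensorProduct.map (LinearMap.mul k B b ∘ₗ C.act c) (LinearMap.mul k H f) w) =
        G w (TensorProduct.assoc k H H H ((Coalgebra.comul (R := k) (A := H)).rTensor H
          (Coalgebra.comul (R := k) h))) := by
    intro w
    induction w with
    | zero => simp [hG0]
    | add x y hx hy => simp only [map_add, hx, hy, hGadd, LinearMap.add_apply]
    | tmul x y => rw [← h4]; simp [leftMul_tmul]
  rw [h1, h2, Coalgebra.coassoc_apply]

theorem rightMul_assoc (x y z : H ⊗[k] B) :
    C.rightMul (C.rightMul x y) z = C.rightMul x (C.rightMul y z) := by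
  induction x with
  | zero => simp
  | add x x' hx hx' => simp only [map_add, LinearMap.add_apply, hx, hx']
  | tmul h a =>
  induction y with
  | zero => simp
  | add x x' hx hx' => simp only [map_add, LinearMap.add_apply, hx, hx']
  | tmul g b =>
  induction z with
  | zero => simp
  | add x x' hx hx' => simp only [map_add, hx, hx']
  | tmul f c =>
  rw [rightMul_tmul, rightMul_tmul]
  -- `G w ((u ⊗ u') ⊗ v) = h w₁ u ⊗ (a ◁ w₂ u') (b ◁ v) c`
  let G (w : H ⊗[k] H) : (H ⊗[k] H) ⊗[k] H →ₗ[k] H ⊗[k] B :=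
    TensorProduct.lift ((LinearMap.mk₂ k (fun (t : H ⊗[k] H) (v : H) =>
      TensorProduct.map (LinearMap.mul k H h)
        ((LinearMap.mul k B).flip (C.act b v * c) ∘ₗ C.act a) (w * t))
      (fun t t' v => by simp [mul_add])
      (fun r t v => by simp)
      (fun t v v' => by
        simp [add_mul, LinearMap.add_comp, TensorProduct.map_add_right])
      (fun r t v => by simp [LinearMap.smul_comp, TensorProduct.map_smul_right])))
  have h1 : ∀ s : H ⊗[k] H,
      C.rightMul (h ⊗ₜ a)
          (TensorProduct.map (LinearMap.mul k H g) ((LinearMap.mul k B).flip c ∘ₗ C.act b) s) =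
        G (Coalgebra.comul (R := k) g)
          ((Coalgebra.comul (R := k) (A := H)).rTensor H s) := by
    intro s
    induction s with
    | zero => simp
    | add x y hx hy => simp only [map_add, hx, hy]
    | tmul x y => simp [rightMul_tmul, G]
  have hG0 : G 0 = 0 := TensorProduct.ext' fun u t => by simp [G]
  have hGadd : ∀ w w', G (w + w') = G w + G w' := fun w w' =>
    TensorProduct.ext' fun u t => by simp [G, add_mul]
  have h3 : ∀ (p q : H) (r : H ⊗[k] H),
      (h * q) ⊗ₜ[k]
          (LinearMap.mul' k B (TensorProduct.map (C.act (C.act a p)) (C.act b) r) * c) =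
        G (1 ⊗ₜ p) ((TensorProduct.assoc k H H H).symm (q ⊗ₜ r)) := by
    intro p q r
    induction r with
    | zero => simp
    | add x y hx hy => simp only [map_add, add_mul, TensorProduct.tmul_add, hx, hy]
    | tmul x y => simp [G, C.act_mul, mul_assoc]
  have h4 : ∀ (p q : H) (s : H ⊗[k] H),
      TensorProduct.map (LinearMap.mul k H (h * q))
          ((LinearMap.mul k B).flip c ∘ₗ C.act (C.act a p * b)) s =
        G (q ⊗ₜ p) ((TensorProduct.assoc k H H H).symm
            ((Coalgebra.comul (R := k) (A := H)).lTensor H s)) := by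
    intro p q s
    have hG1 : ∀ (r : H ⊗[k] H) (y : H),
        G (q ⊗ₜ p) ((TensorProduct.assoc k H H H).symm (y ⊗ₜ r)) =
          G (1 ⊗ₜ p) ((TensorProduct.assoc k H H H).symm ((q * y) ⊗ₜ r)) := by
      intro r y
      induction r with
      | zero => simp
      | add x y hx hy => simp only [map_add, TensorProduct.tmul_add, hx, hy]
      | tmul x y => simp [G]
    induction s with
    | zero => simp
    | add x y hx hy => simp only [map_add, hx, hy]
    | tmul x y =>
      rw [LinearMap.lTensor_tmul, hG1, ← h3]
      simp [C.mul_act, mul_assoc]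
  have h2 : ∀ w : H ⊗[k] H,
      C.rightMul
          (TensorProduct.map (LinearMap.mul k H h) ((LinearMap.mul k B).flip b ∘ₗ C.act a) w)
          (f ⊗ₜ c) =
        G w ((TensorProduct.assoc k H H H).symm ((Coalgebra.comul (R := k) (A := H)).lTensor H
          (Coalgebra.comul (R := k) f))) := by
    intro w
    induction w with
    | zero => simp [hG0]
    | add x y hx hy => simp only [map_add, hx, hy, hGadd, LinearMap.add_apply]
    | tmul x y => rw [← h4]; simp [rightMul_tmul]
  rw [h2, h1, Coalgebra.coassoc_symm_apply]

/-- The algebra `B # H^op`. -/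
instance : Ring C.LeftSmash where
  __ := (inferInstance : AddCommGroup C.LeftSmash)
  mul x y := C.leftMul x y
  one := C.toLeft (1 ⊗ₜ 1)
  mul_assoc := C.leftMul_assoc
  one_mul := C.one_leftMul
  mul_one := C.leftMul_one
  left_distrib x y z := map_add (C.leftMul x) y z
  right_distrib x y z := LinearMap.congr_fun (map_add C.leftMul x y) z
  zero_mul x := LinearMap.congr_fun (map_zero C.leftMul) x
  mul_zero x := map_zero (C.leftMul x)

instance : Algebra k C.LeftSmash :=
  Algebra.ofModule
    (fun r x y => LinearMap.congr_fun (map_smul C.leftMul r x) y)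
    (fun r x y => map_smul (C.leftMul x) r y)

/-- The algebra `H # B`. -/
instance : Ring C.RightSmash where
  __ := (inferInstance : AddCommGroup C.RightSmash)
  mul x y := C.rightMul x y
  one := C.toRight (1 ⊗ₜ 1)
  mul_assoc := C.rightMul_assoc
  one_mul := C.one_rightMul
  mul_one := C.rightMul_one
  left_distrib x y z := map_add (C.rightMul x) y z
  right_distrib x y z := LinearMap.congr_fun (map_add C.rightMul x y) z
  zero_mul x := LinearMap.congr_fun (map_zero C.rightMul) x
  mul_zero x := map_zero (C.rightMul x)

instance : Algebra k C.RightSmash :=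
  Algebra.ofModule
    (fun r x y => LinearMap.congr_fun (map_smul C.rightMul r x) y)
    (fun r x y => map_smul (C.rightMul x) r y)

/-! ### The action bialgebroids -/

/-- The map `a ⊗ h ↦ (a ⊗ h₁) ⊗ (1 ⊗ h₂)`. -/
def leftComulLift : C.LeftSmash →ₗ[k] C.LeftSmash ⊗[k] C.LeftSmash :=
  TensorProduct.map C.toLeft.toLinearMap (C.toLeft.toLinearMap ∘ₗ TensorProduct.mk k B H 1) ∘ₗ
    (TensorProduct.assoc k B H H).symm.toLinearMap ∘ₗ
    (Coalgebra.comul (R := k) (A := H)).lTensor B ∘ₗ C.toLeft.symm.toLinearMap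

/-- The map `h ⊗ a ↦ (h₁ ⊗ 1) ⊗ (h₂ ⊗ a)`. -/
def rightComulLift : C.RightSmash →ₗ[k] C.RightSmash ⊗[k] C.RightSmash :=
  TensorProduct.map (C.toRight.toLinearMap ∘ₗ (TensorProduct.mk k H B).flip 1)
      C.toRight.toLinearMap ∘ₗ
    (TensorProduct.assoc k H H B).toLinearMap ∘ₗ
    (Coalgebra.comul (R := k) (A := H)).rTensor B ∘ₗ C.toRight.symm.toLinearMap

/-- The bialgebroid structure maps of `B # H^op` over `B`: `s(a) = a ⊗ 1`, `t(a) = a₀ ⊗ a₁`,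
`Δ(a ⊗ h) = (a ⊗ h₁) ⊗ (1 ⊗ h₂)`, `ε(a ⊗ h) = a ε(h)`. -/
def leftData : LeftBialgebroidData k B C.LeftSmash where
  source := C.toLeft.toLinearMap ∘ₗ (TensorProduct.mk k B H).flip 1
  target := C.toLeft.toLinearMap ∘ₗ C.coact.toLinearMap
  comul := Submodule.mkQ _ ∘ₗ C.leftComulLift
  counit :=
    (TensorProduct.rid k B).toLinearMap ∘ₗ
      (Coalgebra.counit (R := k) (A := H)).lTensor B ∘ₗ C.toLeft.symm.toLinearMap

/-- The bialgebroid structure maps of `H # B` over `B`: `s(a) = 1 ⊗ a`, `t(a) = S⁻¹(a₁) ⊗ a₀`,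
`Δ(h ⊗ a) = (h₁ ⊗ 1) ⊗ (h₂ ⊗ a)`, `ε(h ⊗ a) = ε(h) a`. -/
def rightData (hS : Function.Bijective (HopfAlgebra.antipode k (A := H))) :
    RightBialgebroidData k B C.RightSmash where
  source := C.toRight.toLinearMap ∘ₗ TensorProduct.mk k H B 1
  target :=
    C.toRight.toLinearMap ∘ₗ (TensorProduct.comm k B H).toLinearMap ∘ₗ
      (antipodeInv hS).lTensor B ∘ₗ C.coact.toLinearMap
  comul := Submodule.mkQ _ ∘ₗ C.rightComulLift
  counit :=
    (TensorProduct.lid k B).toLinearMap ∘ₗ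
      (Coalgebra.counit (R := k) (A := H)).rTensor B ∘ₗ C.toRight.symm.toLinearMap

end General

/-! ### Unitarity -/

section Unitary

variable {H B : Type*} [Ring H] [HopfAlgebra ℂ H] [StarRing H] [StarModule ℂ H]
  [Ring B] [Algebra ℂ B] [StarRing B] [StarModule ℂ B]
variable (C : CrossedModuleAlgebra ℂ H B)

/-- The action is unitary: `(a ◁ h)* = a* ◁ S⁻¹(h*)`. -/
def IsUnitaryAction (hS : Function.Bijective (HopfAlgebra.antipode ℂ (A := H))) : Prop :=
  ∀ (a : B) (h : H), star (C.act a h) = C.act (star a) (antipodeInv hS (star h))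

/-- The coaction is unitary: `(a*)₀ ⊗ (a*)₁ = (a₀)* ⊗ (a₁)*`. -/
def IsUnitaryCoaction : Prop :=
  ∀ a : B, C.coact (star a) = star (C.coact a)

end Unitary

end CrossedModuleAlgebra

end HopfAlgebroids

end

open HopfAlgebroids

noncomputable section

namespace HopfAlgebroids

/-! ## Antipodes -/

section Antipode

variable {k H : Type*} [CommRing k] [Ring H] [HopfAlgebra k H]

/-! Write s and t for the source and target of L = B # H^op, and η(h) = 1 ⊗ h. Every element of L is
a sum of products s(a) η(h), so the theorem reduces to relations between s, t and η: η(h) η(g) = η(g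
h), η(h) s(b) = s(b ◁ h₁) η(h₂), η(h) t(b) = t(b ◁ h₂) η(h₁), s(a) t(b) = t(b) s(a). The third
relation is the crossed module condition (`leftOf_mul_leftTarget`). The fourth is braided
commutativity combined with coassociativity of the coaction
(`IsBraidedCommutative.leftTarget_mul_leftSource`), and it makes t an anti-homomorphism.

Left bialgebroid: the coproduct has a global lift δ to the tensor product over the ground ring, with
s(a) η(h) ↦ s(a) η(h₁) ⊗ η(h₂). This lift is strictly coassociative and strictly multiplicative.
Only the Takeuchi condition and Δ(t(b)) = 1 ⊗ t(b) need the balancing; the former comes from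
comparing the second and third relations. `isLeftBialgebroid_of_lift` passes from δ to arbitrary
representatives.

Right bialgebroid: Φ⁻¹(h ⊗ a) = t(a) η(h), so the third relation says exactly that Φ reverses
products. Since Φ also exchanges sources with targets and is a coalgebra map, every axiom for H # B
is the image of an axiom for L, and nothing is checked in H # B directly.

Hopf conditions: L is a free B-module on H in four ways, through t(a) η(h), η(h) t(a), s(a) η(h) and
η(h) s(a). In such coordinates both sides of the left Hopf map become H ⊗ L, and the map becomes h ⊗
Y ↦ h₁ ⊗ η(h₂) Y, with inverse h ⊗ Y ↦ h₁ ⊗ η(S⁻¹(h₂)) Y. The anti-left map becomes X ⊗ h ↦ η(h₁) X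
⊗ h₂, which is inverted with S. The conditions on H # B follow through Φ.

Involution: S⁻¹(h*) = S(h)*, and Δ ∘ S is the flip of S ⊗ S applied to Δ; together with unitarity
this gives the `*`-relation. The compatibility of the involution σ with Φ says that T = σ Φ⁻¹
squares to the identity. As T is multiplicative, this is checked on generators. -/

open WithConv HopfAlgebra in
-- Uniqueness of convolution inverses in Hom(H, H ⊗ H). The coproduct is the convolution product i₁
-- * i₂ of the two inclusions, so (i₂ ∘ S) * (i₁ ∘ S) is a left inverse of it, while Δ ∘ S is a
-- right inverse.
theorem comul_antipode (h : H) :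
    Coalgebra.comul (R := k) (antipode k h) =
      TensorProduct.map (antipode k) (antipode k)
        (TensorProduct.comm k H H (Coalgebra.comul (R := k) h)) := by
  let i₁ : H →ₐ[k] H ⊗[k] H := Algebra.TensorProduct.includeLeft
  let i₂ : H →ₐ[k] H ⊗[k] H := Algebra.TensorProduct.includeRight
  let S : H →ₗ[k] H := antipode k
  have hS : ∀ i : H →ₐ[k] H ⊗[k] H,
      toConv (i.toLinearMap ∘ₗ S) * toConv i.toLinearMap = 1 := by
    intro i
    have h1 := LinearMap.algHom_comp_convMul_distrib i (toConv S) (toConv LinearMap.id)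
    rw [LinearMap.antipode_mul_id] at h1
    refine WithConv.ofConv_injective ?_
    refine Eq.trans h1.symm ?_
    ext x
    simp [LinearMap.convOne_def]
  have hδ : toConv (Coalgebra.comul (R := k) (A := H)) =
      toConv i₁.toLinearMap * toConv i₂.toLinearMap := by
    ext x
    rw [(Coalgebra.Repr.arbitrary k x).convMul_apply]
    simp [i₁, i₂, (Coalgebra.Repr.arbitrary k x).eq]
  let G : WithConv (H →ₗ[k] H ⊗[k] H) :=
    toConv (i₂.toLinearMap ∘ₗ S) * toConv (i₁.toLinearMap ∘ₗ S)
  have hG : G * toConv (Coalgebra.comul (R := k) (A := H)) = 1 := by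
    calc G * toConv (Coalgebra.comul (R := k) (A := H))
        = toConv (i₂.toLinearMap ∘ₗ S) *
            (toConv (i₁.toLinearMap ∘ₗ S) * toConv i₁.toLinearMap) *
            toConv i₂.toLinearMap := by rw [hδ]; simp only [G, mul_assoc]
      _ = 1 := by rw [hS, mul_one, hS]
  have key := left_inv_eq_right_inv hG LinearMap.comul_right_inv
  have h2 := congrArg (fun f => f.ofConv h) key
  refine Eq.trans h2.symm ?_
  rw [← (Coalgebra.Repr.arbitrary k h).eq]
  refine Eq.trans ((Coalgebra.Repr.arbitrary k h).convMul_apply _ _) ?_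
  simp [i₁, i₂, S]

variable (hS : Function.Bijective (HopfAlgebra.antipode k (A := H)))

@[simp]
theorem antipode_antipodeInv (h : H) : HopfAlgebra.antipode k (antipodeInv hS h) = h :=
  (LinearEquiv.ofBijective (HopfAlgebra.antipode k (A := H)) hS).apply_symm_apply h

@[simp]
theorem antipodeInv_antipode (h : H) : antipodeInv hS (HopfAlgebra.antipode k h) = h :=
  (LinearEquiv.ofBijective (HopfAlgebra.antipode k (A := H)) hS).symm_apply_apply h

theorem antipodeInv_eq_iff {g h : H} :
    antipodeInv hS g = h ↔ g = HopfAlgebra.antipode k h :=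
  ⟨fun e => by rw [← e, antipode_antipodeInv], fun e => by rw [e, antipodeInv_antipode]⟩

/-- `S⁻¹(h₂) h₁ = ε(h)`. -/
theorem mul_antipodeInv_comm_comul (h : H) :
    LinearMap.mul' k H ((antipodeInv hS).rTensor H
      (TensorProduct.comm k H H (Coalgebra.comul (R := k) h))) =
      Coalgebra.counit (R := k) h • (1 : H) := by
  -- Applying the injective S reverses the product and turns S⁻¹(h₂) h₁ into S(h₁) h₂.
  apply hS.1
  have e : ∀ z : H ⊗[k] H, HopfAlgebra.antipode k (LinearMap.mul' k H
      ((antipodeInv hS).rTensor H (TensorProduct.comm k H H z))) =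
      LinearMap.mul' k H ((HopfAlgebra.antipode k).rTensor H z) := fun z => by
    induction z with
    | zero => simp
    | add x y hx hy => simp only [map_add, hx, hy]
    | tmul x y => simp [HopfAlgebra.antipode_mul_antidistrib]
  rw [e, HopfAlgebra.mul_antipode_rTensor_comul_apply, map_smul, HopfAlgebra.antipode_one,
    Algebra.algebraMap_eq_smul_one]

/-- `h₂ S⁻¹(h₁) = ε(h)`. -/
theorem mul_antipodeInv_comm_comul' (h : H) :
    LinearMap.mul' k H ((antipodeInv hS).lTensor H
      (TensorProduct.comm k H H (Coalgebra.comul (R := k) h))) =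
      Coalgebra.counit (R := k) h • (1 : H) := by
  apply hS.1
  have e : ∀ z : H ⊗[k] H, HopfAlgebra.antipode k (LinearMap.mul' k H
      ((antipodeInv hS).lTensor H (TensorProduct.comm k H H z))) =
      LinearMap.mul' k H ((HopfAlgebra.antipode k).lTensor H z) := fun z => by
    induction z with
    | zero => simp
    | add x y hx hy => simp only [map_add, hx, hy]
    | tmul x y => simp [HopfAlgebra.antipode_mul_antidistrib]
  rw [e, HopfAlgebra.mul_antipode_lTensor_comul_apply, map_smul, HopfAlgebra.antipode_one,
    Algebra.algebraMap_eq_smul_one]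

end Antipode

/-! ## Twisting by a convolution-invertible action -/

section Twist

variable {k H V M : Type*} [CommRing k] [AddCommGroup H] [Module k H]
  [AddCommGroup V] [Module k V] [AddCommGroup M] [Module k M]

/-- The map `v ⊗ m ↦ v₀ ⊗ ρ(v₁) m`. -/
def twist (δ : V →ₗ[k] V ⊗[k] H) (ρ : H →ₗ[k] M →ₗ[k] M) : V ⊗[k] M →ₗ[k] V ⊗[k] M :=
  (TensorProduct.lift ρ).lTensor V ∘ₗ (TensorProduct.assoc k V H M).toLinearMap ∘ₗ δ.rTensor M

/-- The map `m ⊗ v ↦ ρ(v₋₁) m ⊗ v₀`. -/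
def twistLeft (δ : V →ₗ[k] H ⊗[k] V) (ρ : H →ₗ[k] M →ₗ[k] M) : M ⊗[k] V →ₗ[k] M ⊗[k] V :=
  (TensorProduct.lift ρ.flip).rTensor V ∘ₗ (TensorProduct.assoc k M H V).symm.toLinearMap ∘ₗ
    δ.lTensor M

theorem twist_tmul (δ : V →ₗ[k] V ⊗[k] H) (ρ : H →ₗ[k] M →ₗ[k] M) (v : V) (m : M) :
    twist δ ρ (v ⊗ₜ m) = (ρ.flip m).lTensor V (δ v) := by
  simp only [twist, LinearMap.comp_apply, LinearMap.rTensor_tmul, LinearEquiv.coe_coe]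
  generalize δ v = z
  induction z with
  | zero => simp
  | add x y hx hy => simp only [map_add, TensorProduct.add_tmul, hx, hy]
  | tmul x y => simp

theorem twistLeft_tmul (δ : V →ₗ[k] H ⊗[k] V) (ρ : H →ₗ[k] M →ₗ[k] M) (v : V) (m : M) :
    twistLeft δ ρ (m ⊗ₜ v) = (ρ.flip m).rTensor V (δ v) := by
  simp only [twistLeft, LinearMap.comp_apply, LinearMap.lTensor_tmul, LinearEquiv.coe_coe]
  generalize δ v = z
  induction z with
  | zero => simp
  | add x y hx hy => simp only [map_add, TensorProduct.tmul_add, hx, hy]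
  | tmul x y => simp

variable [Coalgebra k H]

/-- Coassociativity rewrites the composite as v₀ ⊗ ρ(v₁) ρ'(v₂) m. Hypothesis `h` says that ρ and ρ'
are convolution inverse on this side, so the counit is all that remains. -/
theorem twist_twist {δ : V →ₗ[k] V ⊗[k] H}
    (hδ : ∀ v, TensorProduct.assoc k V H H (δ.rTensor H (δ v)) =
      (Coalgebra.comul (R := k) (A := H)).lTensor V (δ v))
    (hε : ∀ v, TensorProduct.rid k V ((Coalgebra.counit (R := k) (A := H)).lTensor V (δ v)) = v)
    {ρ ρ' : H →ₗ[k] M →ₗ[k] M}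
    (h : ∀ x m, TensorProduct.lift (ρ.compl₂ (ρ'.flip m)) (Coalgebra.comul (R := k) x) =
      Coalgebra.counit (R := k) x • m) (z : V ⊗[k] M) :
    twist δ ρ (twist δ ρ' z) = z := by
  induction z with
  | zero => simp
  | add x y hx hy => simp only [map_add, hx, hy]
  | tmul v m =>
  have e1 : ∀ w : V ⊗[k] H, twist δ ρ ((ρ'.flip m).lTensor V w) =
      (TensorProduct.lift (ρ.compl₂ (ρ'.flip m))).lTensor V
        (TensorProduct.assoc k V H H (δ.rTensor H w)) := fun w => by
    induction w with
    | zero => simp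
    | add x y hx hy => simp only [map_add, hx, hy]
    | tmul x y =>
      rw [LinearMap.lTensor_tmul, twist_tmul, LinearMap.rTensor_tmul]
      generalize δ x = u
      induction u with
      | zero => simp
      | add x y hx hy => simp only [map_add, TensorProduct.add_tmul, hx, hy]
      | tmul x y => simp
  have e2 : ∀ w : V ⊗[k] H, (TensorProduct.lift (ρ.compl₂ (ρ'.flip m))).lTensor V
      ((Coalgebra.comul (R := k) (A := H)).lTensor V w) =
      TensorProduct.rid k V ((Coalgebra.counit (R := k) (A := H)).lTensor V w) ⊗ₜ[k] m :=
    fun w => by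
    induction w with
    | zero => simp
    | add x y hx hy => simp only [map_add, TensorProduct.add_tmul, hx, hy]
    | tmul x y =>
      rw [LinearMap.lTensor_tmul, LinearMap.lTensor_tmul, h]
      simp [TensorProduct.smul_tmul]
  rw [twist_tmul, e1, hδ, e2, hε]

/-- For a left comodule the inner map consumes the outermost leg, so the composite is ρ(x₂) ρ'(x₁);
hence the flip in `h`. -/
theorem twistLeft_twistLeft {δ : V →ₗ[k] H ⊗[k] V}
    (hδ : ∀ v, TensorProduct.assoc k H H V
      ((Coalgebra.comul (R := k) (A := H)).rTensor V (δ v)) = δ.lTensor H (δ v))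
    (hε : ∀ v, TensorProduct.lid k V ((Coalgebra.counit (R := k) (A := H)).rTensor V (δ v)) = v)
    {ρ ρ' : H →ₗ[k] M →ₗ[k] M}
    (h : ∀ x m, TensorProduct.lift (ρ.compl₂ (ρ'.flip m))
      (TensorProduct.comm k H H (Coalgebra.comul (R := k) x)) =
      Coalgebra.counit (R := k) x • m) (z : M ⊗[k] V) :
    twistLeft δ ρ (twistLeft δ ρ' z) = z := by
  induction z with
  | zero => simp
  | add x y hx hy => simp only [map_add, hx, hy]
  | tmul m v =>
  have e1 : ∀ w : H ⊗[k] V, twistLeft δ ρ ((ρ'.flip m).rTensor V w) =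
      (TensorProduct.lift (ρ.compl₂ (ρ'.flip m)) ∘ₗ
        (TensorProduct.comm k H H).toLinearMap).rTensor V
        ((TensorProduct.assoc k H H V).symm (δ.lTensor H w)) := fun w => by
    induction w with
    | zero => simp
    | add x y hx hy => simp only [map_add, hx, hy]
    | tmul x y =>
      rw [LinearMap.rTensor_tmul, twistLeft_tmul, LinearMap.lTensor_tmul]
      generalize δ y = u
      induction u with
      | zero => simp
      | add x y hx hy => simp only [map_add, TensorProduct.tmul_add, hx, hy]
      | tmul x y => simp
  have e2 : ∀ w : H ⊗[k] V, (TensorProduct.lift (ρ.compl₂ (ρ'.flip m)) ∘ₗ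
        (TensorProduct.comm k H H).toLinearMap).rTensor V
      ((Coalgebra.comul (R := k) (A := H)).rTensor V w) =
      m ⊗ₜ[k] TensorProduct.lid k V ((Coalgebra.counit (R := k) (A := H)).rTensor V w) :=
    fun w => by
    induction w with
    | zero => simp
    | add x y hx hy => simp only [map_add, TensorProduct.tmul_add, hx, hy]
    | tmul x y =>
      rw [LinearMap.rTensor_tmul, LinearMap.rTensor_tmul, LinearMap.comp_apply,
        LinearEquiv.coe_coe, h]
      simp [TensorProduct.smul_tmul]
  rw [twistLeft_tmul, e1, ← hδ, LinearEquiv.symm_apply_apply, e2, hε]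

end Twist

/-! ## The flip on balanced tensor products -/

section BalancedComm

variable {k A L : Type*} [CommRing k] [AddCommGroup L] [Module k L]

theorem balancedRel_le_ker_comm (p q : A → L → L) :
    balancedRel k p q ≤ LinearMap.ker ((balancedRel k q p).mkQ ∘ₗ
      (TensorProduct.comm k L L).toLinearMap) := by
  refine Submodule.span_le.2 ?_
  rintro z ⟨b, x, y, rfl⟩
  refine LinearMap.mem_ker.2 ?_
  simp only [map_sub, LinearMap.comp_apply, LinearEquiv.coe_coe, TensorProduct.comm_tmul]
  rw [← neg_sub, neg_eq_zero, ← map_sub, Submodule.mkQ_apply, Submodule.Quotient.mk_eq_zero]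
  exact Submodule.subset_span ⟨b, y, x, rfl⟩

/-- The flip on balanced tensor products. -/
def balancedComm (p q : A → L → L) : BalancedTensor k p q ≃ₗ[k] BalancedTensor k q p :=
  LinearEquiv.ofLinearMap
    ((balancedRel k p q).liftQ _ (balancedRel_le_ker_comm p q))
    ((balancedRel k q p).liftQ _ (balancedRel_le_ker_comm q p))
    (Submodule.linearMap_qext _ (TensorProduct.ext' fun x y => by simp))
    (Submodule.linearMap_qext _ (TensorProduct.ext' fun x y => by simp))

@[simp]
theorem balancedComm_mk (p q : A → L → L) (z : L ⊗[k] L) :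
    balancedComm p q (Submodule.Quotient.mk z) =
      Submodule.Quotient.mk (TensorProduct.comm k L L z) := rfl

end BalancedComm

/-! ## Balanced tensor products of free modules -/

section BalancedFree

variable {k A V L : Type*} [CommRing k] [Ring A] [Algebra k A] [AddCommGroup V] [Module k V]
  [AddCommGroup L] [Module k L]

/-- If `L` is free on `V` for the action `p`, then `L ⊗_A L` is `V ⊗ L`. -/
theorem exists_equiv_balancedTensor_left {p q : A → L → L} (ψ : V ⊗[k] A ≃ₗ[k] L)
    (P Q : A →ₗ[k] L →ₗ[k] L) (hP : ∀ a y, P a y = p a y) (hQ : ∀ a y, Q a y = q a y)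
    (hQ1 : ∀ y, Q 1 y = y) (m : A → A → A) (hm1 : ∀ b, m b 1 = b)
    (hp : ∀ b v a, p b (ψ (v ⊗ₜ a)) = ψ (v ⊗ₜ m b a))
    (hm : ∀ b a y, Q (m b a) y = Q a (Q b y)) :
    ∃ e : V ⊗[k] L ≃ₗ[k] BalancedTensor k p q,
      ∀ v y, e (v ⊗ₜ y) = Submodule.Quotient.mk (ψ (v ⊗ₜ 1) ⊗ₜ y) := by
  let f : V ⊗[k] L →ₗ[k] BalancedTensor k p q :=
    (balancedRel k p q).mkQ ∘ₗ (ψ.toLinearMap ∘ₗ (TensorProduct.mk k V A).flip 1).rTensor L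
  -- The inverse moves the coefficient of the first factor across the tensor sign: ψ(v ⊗ a) ⊗ y ↦ v
  -- ⊗ Q(a) y. The product `m` on coefficients is kept abstract because both a b and b a occur in
  -- the applications.
  let g₀ : L ⊗[k] L →ₗ[k] V ⊗[k] L :=
    (TensorProduct.lift Q).lTensor V ∘ₗ (TensorProduct.assoc k V A L).toLinearMap ∘ₗ
      ψ.symm.toLinearMap.rTensor L
  have hg₀ : ∀ v a y, g₀ (ψ (v ⊗ₜ a) ⊗ₜ y) = v ⊗ₜ Q a y := fun v a y => by simp [g₀]
  have hker : balancedRel k p q ≤ LinearMap.ker g₀ := by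
    refine Submodule.span_le.2 ?_
    rintro z ⟨b, x, y, rfl⟩
    refine LinearMap.mem_ker.2 ?_
    rw [map_sub, sub_eq_zero, ← hP]
    obtain ⟨w, rfl⟩ := ψ.surjective x
    induction w with
    | zero => simp
    | add x y hx hy => simp only [map_add, TensorProduct.add_tmul, hx, hy]
    | tmul v a => rw [hP, hp, hg₀, hg₀, hm, ← hQ b y]
  let g := (balancedRel k p q).liftQ g₀ hker
  have hfg : f ∘ₗ g = LinearMap.id := by
    refine Submodule.linearMap_qext _ (TensorProduct.ext' fun x y => ?_)
    obtain ⟨w, rfl⟩ := ψ.surjective x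
    induction w with
    | zero => simp
    | add x y hx hy => simp only [map_add, TensorProduct.add_tmul, hx, hy]
    | tmul v a =>
      have h1 : (f ∘ₗ g) ((balancedRel k p q).mkQ (ψ (v ⊗ₜ a) ⊗ₜ y)) = f (v ⊗ₜ Q a y) := by
        simp only [LinearMap.comp_apply, g, Submodule.mkQ_apply, Submodule.liftQ_apply, hg₀]
      have h2 := hp a v 1
      rw [hm1] at h2
      refine h1.trans (Eq.symm ((Submodule.Quotient.eq _).2 (Submodule.subset_span
        ⟨a, ψ (v ⊗ₜ 1), y, ?_⟩)))
      simp [h2, hQ]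
  have hgf : g ∘ₗ f = LinearMap.id := TensorProduct.ext' fun v y => by simp [f, g, hg₀, hQ1]
  exact ⟨LinearEquiv.ofLinearMap f g hfg hgf, fun v y => rfl⟩

/-- If `L` is free on `V` for the action `q`, then `L ⊗_A L` is `L ⊗ V`. -/
theorem exists_equiv_balancedTensor_right {p q : A → L → L} (ψ : V ⊗[k] A ≃ₗ[k] L)
    (P Q : A →ₗ[k] L →ₗ[k] L) (hP : ∀ a y, P a y = p a y) (hQ : ∀ a y, Q a y = q a y)
    (hP1 : ∀ y, P 1 y = y) (m : A → A → A) (hm1 : ∀ b, m b 1 = b)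
    (hq : ∀ b v a, q b (ψ (v ⊗ₜ a)) = ψ (v ⊗ₜ m b a))
    (hm : ∀ b a y, P (m b a) y = P a (P b y)) :
    ∃ e : L ⊗[k] V ≃ₗ[k] BalancedTensor k p q,
      ∀ v y, e (y ⊗ₜ v) = Submodule.Quotient.mk (y ⊗ₜ ψ (v ⊗ₜ 1)) := by
  obtain ⟨e, he⟩ := exists_equiv_balancedTensor_left (k := k) ψ Q P hQ hP hP1 m hm1 hq hm
  refine ⟨TensorProduct.comm k L V ≪≫ₗ e ≪≫ₗ balancedComm q p, fun v y => ?_⟩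
  simp only [LinearEquiv.trans_apply, TensorProduct.comm_tmul, he, balancedComm_mk]

end BalancedFree

/-! ## Independence of representatives -/

section Representatives

variable {k A L : Type*} [CommRing k] [AddCommGroup L] [Module k L]

/-- A balanced map takes the same value on all representatives. -/
theorem balanced_congr {k' M : Type*} [CommRing k'] {τ : k →+* k'} [AddCommGroup M] [Module k' M]
    {p q : A → L → L} (f : L ⊗[k] L →ₛₗ[τ] M)
    (hf : ∀ a x y, f (p a x ⊗ₜ y) = f (x ⊗ₜ q a y)) {u v : L ⊗[k] L}
    (h : (balancedRel k p q).mkQ u = (balancedRel k p q).mkQ v) : f u = f v := by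
  have hle : balancedRel k p q ≤ LinearMap.ker f := by
    refine Submodule.span_le.2 ?_
    rintro z ⟨a, x, y, rfl⟩
    refine LinearMap.mem_ker.2 ?_
    rw [map_sub, hf, sub_self]
  rw [← sub_eq_zero, ← map_sub]
  exact LinearMap.mem_ker.1 (hle ((Submodule.Quotient.eq _).1 h))

theorem balanced_tmul (p q : A → L → L) (a : A) (x y : L) :
    (balancedRel k p q).mkQ (p a x ⊗ₜ y) = (balancedRel k p q).mkQ (x ⊗ₜ q a y) :=
  (Submodule.Quotient.eq _).2 (Submodule.subset_span ⟨a, x, y, rfl⟩)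

@[simp]
theorem joinLeft_mk (p q : A → L → L) (u : L ⊗[k] L) (z : L) :
    joinLeft p q ((balancedRel k p q).mkQ u ⊗ₜ z) =
      (balancedRel₃ k p q).mkQ (TensorProduct.assoc k L L L (u ⊗ₜ z)) := rfl

@[simp]
theorem joinRight_mk (p q : A → L → L) (u : L ⊗[k] L) (z : L) :
    joinRight p q (z ⊗ₜ (balancedRel k p q).mkQ u) =
      (balancedRel₃ k p q).mkQ (z ⊗ₜ u) := rfl

end Representatives

/-! ### Left bialgebroids whose coproduct lifts to the unbalanced tensor product -/

namespace LeftBialgebroidData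

variable {k A L : Type*} [CommRing k] [Ring A] [Algebra k A] [Ring L] [Algebra k L]
variable (D : LeftBialgebroidData k A L)

theorem proj_target_mul (a : A) (x y : L) :
    D.proj ((D.target a * x) ⊗ₜ y) = D.proj (x ⊗ₜ (D.source a * y)) :=
  balanced_tmul (fun a x => D.target a * x) (fun a y => D.source a * y) a x y

variable {D}

/-- Semilinear maps are allowed so that the antilinear involution is covered too. -/
theorem proj_congr {k' M : Type*} [CommRing k'] {τ : k →+* k'} [AddCommGroup M] [Module k' M]
    (f : L ⊗[k] L →ₛₗ[τ] M)
    (hf : ∀ a x y, f ((D.target a * x) ⊗ₜ y) = f (x ⊗ₜ (D.source a * y))) {u v : L ⊗[k] L}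
    (h : D.proj u = D.proj v) : f u = f v :=
  balanced_congr f hf h

/-- The balancing relations involve left multiplications only, and these commute with right
multiplication by any `w`. Left multiplication descends only under extra conditions, given in the
next two lemmas. -/
theorem proj_mul_right {u v : L ⊗[k] L} (h : D.proj u = D.proj v) (w : L ⊗[k] L) :
    D.proj (u * w) = D.proj (v * w) := by
  refine proj_congr (D.proj ∘ₗ LinearMap.mulRight k w) (fun a x y => ?_) h
  simp only [LinearMap.comp_apply, LinearMap.mulRight_apply]
  induction w with
  | zero => simp
  | add x y hx hy => simp only [mul_add, map_add, hx, hy]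
  | tmul x' y' => simp only [Algebra.TensorProduct.tmul_mul_tmul, mul_assoc, D.proj_target_mul]

theorem proj_mul_left_tmul {x y : L} (hx : ∀ a, x * D.target a = D.target a * x)
    (hy : ∀ a, y * D.source a = D.source a * y) {u v : L ⊗[k] L} (h : D.proj u = D.proj v) :
    D.proj ((x ⊗ₜ y) * u) = D.proj ((x ⊗ₜ y) * v) := by
  refine proj_congr (D.proj ∘ₗ LinearMap.mulLeft k (x ⊗ₜ y)) (fun a x' y' => ?_) h
  simp only [LinearMap.comp_apply, LinearMap.mulLeft_apply, Algebra.TensorProduct.tmul_mul_tmul]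
  rw [← mul_assoc, hx, mul_assoc, D.proj_target_mul, ← mul_assoc, ← hy, mul_assoc]

/-- This is the purpose of the Takeuchi condition: multiplying `hw` on the right by x ⊗ y shows that
left multiplication by `w` respects the balancing relations. -/
theorem proj_mul_left {u v w : L ⊗[k] L}
    (hw : ∀ a, D.proj (w * (D.target a ⊗ₜ 1)) = D.proj (w * (1 ⊗ₜ D.source a)))
    (h : D.proj u = D.proj v) : D.proj (w * u) = D.proj (w * v) := by
  refine proj_congr (D.proj ∘ₗ LinearMap.mulLeft k w) (fun a x y => ?_) h
  have := proj_mul_right (hw a) (x ⊗ₜ y)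
  simpa only [mul_assoc, Algebra.TensorProduct.tmul_mul_tmul, one_mul, LinearMap.comp_apply,
    LinearMap.mulLeft_apply] using this

/-- The axioms of a left bialgebroid whose coproduct is given by a map to `L ⊗ L` only need to be
checked on these representatives. -/
theorem isLeftBialgebroid_of_lift (δ : L →ₗ[k] L ⊗[k] L) (hδ : ∀ X, D.comul X = D.proj (δ X))
    (source_one : D.source 1 = 1)
    (source_mul : ∀ a b, D.source (a * b) = D.source a * D.source b)
    (target_one : D.target 1 = 1)
    (target_mul : ∀ a b, D.target (a * b) = D.target b * D.target a)
    (source_target_comm : ∀ a b, D.source a * D.target b = D.target b * D.source a)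
    (δ_source : ∀ a, δ (D.source a) = D.source a ⊗ₜ 1)
    (comul_target : ∀ a, D.proj (δ (D.target a)) = D.proj (1 ⊗ₜ D.target a))
    (counit_source_mul : ∀ a X, D.counit (D.source a * X) = a * D.counit X)
    (counit_target_mul : ∀ a X, D.counit (D.target a * X) = D.counit X * a)
    (coassoc : ∀ X, TensorProduct.assoc k L L L (δ.rTensor L (δ X)) = δ.lTensor L (δ X))
    (counit_comul : ∀ X, LinearMap.mul' k L ((D.source ∘ₗ D.counit).rTensor L (δ X)) = X)
    (comul_counit : ∀ X, LinearMap.mul' k L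
      ((D.target ∘ₗ D.counit).rTensor L (TensorProduct.comm k L L (δ X))) = X)
    (takeuchi : ∀ a X, D.proj (δ X * (D.target a ⊗ₜ 1)) = D.proj (δ X * (1 ⊗ₜ D.source a)))
    (δ_mul : ∀ X Y, δ (X * Y) = δ X * δ Y)
    (counit_one : D.counit 1 = 1)
    (counit_mul_source : ∀ X Y, D.counit (X * Y) = D.counit (X * D.source (D.counit Y)))
    (counit_mul_target : ∀ X Y, D.counit (X * Y) = D.counit (X * D.target (D.counit Y))) :
    D.IsLeftBialgebroid := by
  have comul_source_mul : ∀ a X u, D.proj u = D.comul X →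
      D.comul (D.source a * X) = D.proj ((D.source a ⊗ₜ 1) * u) := fun a X u hu => by
    rw [hδ, δ_mul, δ_source]
    exact proj_mul_left_tmul (fun b => source_target_comm a b) (fun b => by simp)
      ((hu.trans (hδ X)).symm)
  have comul_target_mul : ∀ a X u, D.proj u = D.comul X →
      D.comul (D.target a * X) = D.proj ((1 ⊗ₜ D.target a) * u) := fun a X u hu => by
    rw [hδ, δ_mul, proj_mul_right (comul_target a)]
    exact proj_mul_left_tmul (fun b => by simp) (fun b => (source_target_comm b a).symm)
      ((hu.trans (hδ X)).symm)
  -- The Takeuchi condition involves right multiplication only, so it passes from δ X to every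
  -- representative.
  have rep_takeuchi : ∀ a X u, D.proj u = D.comul X →
      D.proj (u * (D.target a ⊗ₜ 1)) = D.proj (u * (1 ⊗ₜ D.source a)) := fun a X u hu => by
    have h := hu.trans (hδ X)
    rw [proj_mul_right h, proj_mul_right h, takeuchi]
  refine
    { source_one, source_mul, target_one, target_mul, source_target_comm, comul_source_mul,
      comul_target_mul, counit_source_mul, counit_target_mul, counit_one, counit_mul_source,
      counit_mul_target, takeuchi := rep_takeuchi, coassoc := ?_, counit_comul := ?_,
      comul_counit := ?_, comul_one := ?_, comul_mul := ?_ }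
  · intro X u hu
    have h := hu.trans (hδ X)
    have hl : ∀ w : L ⊗[k] L, joinLeft (k := k) (fun a x => D.target a * x)
        (fun a y => D.source a * y) (D.comul.rTensor L w) = (balancedRel₃ k _ _).mkQ
          (TensorProduct.assoc k L L L (δ.rTensor L w)) := fun w => by
      induction w with
      | zero => simp
      | add x y hx hy => simp only [map_add, hx, hy]
      | tmul x y => rw [LinearMap.rTensor_tmul, hδ]; rfl
    have hr : ∀ w : L ⊗[k] L, joinRight (k := k) (fun a x => D.target a * x)
        (fun a y => D.source a * y) (D.comul.lTensor L w) = (balancedRel₃ k _ _).mkQ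
          (δ.lTensor L w) := fun w => by
      induction w with
      | zero => simp
      | add x y hx hy => simp only [map_add, hx, hy]
      | tmul x y => rw [LinearMap.lTensor_tmul, hδ]; rfl
    -- Both iterated coproducts depend only on the class of `u`, because Δ is a bimodule map; after
    -- replacing `u` by δ X, strict coassociativity of δ finishes.
    have hl' := proj_congr (joinLeft (k := k) (fun a x => D.target a * x)
        (fun a y => D.source a * y) ∘ₗ D.comul.rTensor L) (fun a x y => ?_) h
    have hr' := proj_congr (joinRight (k := k) (fun a x => D.target a * x)
        (fun a y => D.source a * y) ∘ₗ D.comul.lTensor L) (fun a x y => ?_) h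
    · simp only [LinearMap.comp_apply] at hl' hr'
      rw [hl', hr', hl, hr, coassoc]
    · simp only [LinearMap.comp_apply, LinearMap.lTensor_tmul]
      rw [comul_source_mul a y _ (hδ y).symm, hδ, joinRight_mk, joinRight_mk]
      generalize δ y = w
      induction w with
      | zero => simp
      | add x y hx hy => simp only [mul_add, map_add, TensorProduct.tmul_add, hx, hy]
      | tmul y z =>
        rw [Algebra.TensorProduct.tmul_mul_tmul, one_mul]
        exact (Submodule.Quotient.eq _).2 (Submodule.subset_span (Or.inl ⟨a, x, y, z, rfl⟩))
    · simp only [LinearMap.comp_apply, LinearMap.rTensor_tmul]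
      rw [comul_target_mul a x _ (hδ x).symm, hδ, joinLeft_mk, joinLeft_mk]
      generalize δ x = w
      induction w with
      | zero => simp
      | add x y hx hy => simp only [mul_add, map_add, TensorProduct.add_tmul, hx, hy]
      | tmul x z =>
        rw [Algebra.TensorProduct.tmul_mul_tmul, one_mul, TensorProduct.assoc_tmul,
          TensorProduct.assoc_tmul]
        exact ((Submodule.Quotient.eq _).2
          (Submodule.subset_span (Or.inr ⟨a, x, z, y, rfl⟩)))
  · intro X u hu
    refine Eq.trans ?_ (counit_comul X)
    refine proj_congr (LinearMap.mul' k L ∘ₗ (D.source ∘ₗ D.counit).rTensor L) (fun a x y => ?_)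
      (hu.trans (hδ X))
    simp [counit_target_mul, source_mul, mul_assoc]
  · intro X u hu
    refine Eq.trans ?_ (comul_counit X)
    refine proj_congr (LinearMap.mul' k L ∘ₗ (D.target ∘ₗ D.counit).rTensor L ∘ₗ
      (TensorProduct.comm k L L).toLinearMap) (fun a x y => ?_) (hu.trans (hδ X))
    simp [counit_source_mul, target_mul, mul_assoc]
  · rw [hδ, ← source_one, δ_source, source_one]
  · intro X Y u v hu hv
    rw [hδ, δ_mul, ← proj_mul_right (hu.trans (hδ X)),
      proj_mul_left (fun a => rep_takeuchi a X u hu) (hv.trans (hδ Y))]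

end LeftBialgebroidData

namespace CrossedModuleAlgebra

section Smash

variable {k H B : Type*} [CommRing k] [Ring H] [HopfAlgebra k H] [Ring B] [Algebra k B]
variable (C : CrossedModuleAlgebra k H B)

/-! ## Generators and relations of `B # H^op` -/

/-- The map `h ↦ 1 ⊗ h` from `H` to `B # H^op`. -/
def leftOf : H →ₗ[k] C.LeftSmash := C.toLeft.toLinearMap ∘ₗ TensorProduct.mk k B H 1

theorem toLeft_mul_toLeft (x y : B ⊗[k] H) :
    C.toLeft x * C.toLeft y = C.toLeft (C.leftMul x y) := rfl

theorem leftSource_apply (a : B) : C.leftData.source a = C.toLeft (a ⊗ₜ 1) := rfl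

theorem leftTarget_apply (a : B) : C.leftData.target a = C.toLeft (C.coact a) := rfl

theorem leftOf_apply (h : H) : C.leftOf h = C.toLeft (1 ⊗ₜ h) := rfl

@[simp]
theorem leftSource_one : C.leftData.source 1 = 1 := rfl

@[simp]
theorem leftOf_one : C.leftOf 1 = 1 := rfl

theorem leftSource_mul_toLeft (a b : B) (h : H) :
    C.leftData.source a * C.toLeft (b ⊗ₜ h) = C.toLeft ((a * b) ⊗ₜ h) := by
  rw [leftSource_apply, toLeft_mul_toLeft, leftMul_tmul, Bialgebra.comul_one,
    Algebra.TensorProduct.one_def]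
  simp [C.act_one]

/-- The normal form on which linear identities in B # H^op are tested; it underlies
`leftSmash_induction`. -/
theorem toLeft_tmul (a : B) (h : H) :
    C.toLeft (a ⊗ₜ h) = C.leftData.source a * C.leftOf h := by
  rw [leftOf_apply, leftSource_mul_toLeft, mul_one]

theorem leftSource_mul (a b : B) :
    C.leftData.source (a * b) = C.leftData.source a * C.leftData.source b := by
  conv_rhs => rw [C.leftSource_apply b, leftSource_mul_toLeft]
  rfl

theorem leftSmash_induction {P : C.LeftSmash → Prop} (zero : P 0)
    (add : ∀ X Y, P X → P Y → P (X + Y))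
    (source_mul_of : ∀ a h, P (C.leftData.source a * C.leftOf h)) (X : C.LeftSmash) : P X := by
  obtain ⟨z, rfl⟩ := C.toLeft.surjective X
  induction z with
  | zero => simpa using zero
  | add x y hx hy => rw [map_add]; exact add _ _ hx hy
  | tmul a h => rw [toLeft_tmul]; exact source_mul_of a h

/-- Since 1 ◁ h₁ = ε(h₁) 1, the first leg of Δ(h) disappears. -/
theorem leftOf_mul_leftOf (h g : H) : C.leftOf h * C.leftOf g = C.leftOf (g * h) := by
  rw [leftOf_apply, leftOf_apply, toLeft_mul_toLeft, leftMul_tmul]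
  have key : ∀ z : H ⊗[k] H,
      TensorProduct.map (LinearMap.mul k B 1 ∘ₗ C.act 1) (LinearMap.mul k H g) z =
        1 ⊗ₜ[k] (g * TensorProduct.lid k H
          ((Coalgebra.counit (R := k) (A := H)).rTensor H z)) := by
    intro z
    induction z with
    | zero => simp
    | add x y hx hy => simp only [map_add, hx, hy, mul_add, TensorProduct.tmul_add]
    | tmul x y => simp [C.one_act, TensorProduct.smul_tmul]
  rw [key, Coalgebra.rTensor_counit_comul, TensorProduct.lid_tmul, one_smul]
  rfl

/-- `η(h) s(b) = s(b ◁ h₁) η(h₂)`. -/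
theorem leftOf_mul_leftSource (h : H) (b : B) :
    C.leftOf h * C.leftData.source b =
      LinearMap.mul' k _ (TensorProduct.map (C.leftData.source ∘ₗ C.act b) C.leftOf
        (Coalgebra.comul (R := k) h)) := by
  rw [leftOf_apply, leftSource_apply, toLeft_mul_toLeft, leftMul_tmul]
  generalize Coalgebra.comul (R := k) h = z
  induction z with
  | zero => simp
  | add x y hx hy => simp only [map_add, hx, hy]
  | tmul x y => simp [toLeft_tmul]

/-- `η(h) t(b) = t(b ◁ h₂) η(h₁)`. -/
theorem leftOf_mul_leftTarget (h : H) (b : B) :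
    C.leftOf h * C.leftData.target b =
      LinearMap.mul' k _ (TensorProduct.map (C.leftData.target ∘ₗ C.act b) C.leftOf
        (TensorProduct.comm k H H (Coalgebra.comul (R := k) h))) := by
  -- The product on the right is that of the ordinary tensor algebra B ⊗ H, in which the crossed
  -- module condition is stated. Right multiplication by η(g) becomes left multiplication by 1 ⊗ g,
  -- because η reverses products.
  have h1 : ∀ (c : B) (g : H), C.leftData.target c * C.leftOf g =
      C.toLeft ((1 ⊗ₜ g) * C.coact c) := fun c g => by
    rw [leftTarget_apply]
    generalize C.coact c = z
    induction z with
    | zero => simp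
    | add x y hx hy => simp only [map_add, add_mul, mul_add, hx, hy]
    | tmul x y =>
      rw [toLeft_tmul, mul_assoc, leftOf_mul_leftOf, ← toLeft_tmul,
        Algebra.TensorProduct.tmul_mul_tmul, one_mul]
  have h2 : ∀ z : H ⊗[k] H, LinearMap.mul' k _
      (TensorProduct.map (C.leftData.target ∘ₗ C.act b) C.leftOf (TensorProduct.comm k H H z)) =
      C.toLeft (LinearMap.mul' k (B ⊗[k] H)
        (TensorProduct.map (TensorProduct.mk k B H 1) (C.coact.toLinearMap ∘ₗ C.act b) z)) :=
    fun z => by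
    induction z with
    | zero => simp
    | add x y hx hy => simp only [map_add, hx, hy]
    | tmul x y => simp [h1]
  have h3 : ∀ z : B ⊗[k] H, C.leftOf h * C.toLeft z =
      C.toLeft (TensorProduct.map₂ C.act (LinearMap.mul k H) z (Coalgebra.comul (R := k) h)) :=
    fun z => by
    induction z with
    | zero => simp
    | add x y hx hy => simp only [map_add, mul_add, hx, hy, LinearMap.add_apply]
    | tmul x g =>
      rw [leftOf_apply, toLeft_mul_toLeft, leftMul_tmul]
      congr 1
      generalize Coalgebra.comul (R := k) h = w
      induction w with
      | zero => simp
      | add x y hx hy => simp only [map_add, hx, hy]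
      | tmul x y => simp
  rw [leftTarget_apply, h3, h2, C.crossed]

variable {C}

/-- t(b) s(a) = s(b₀) η(b₁) s(a) = s(b₀ (a ◁ b₁)) η(b₂) = s(a b₀) η(b₁) = s(a) t(b). The third
equality applies braided commutativity to b₀, after coassociativity has regrouped the coaction. -/
theorem IsBraidedCommutative.leftTarget_mul_leftSource (hC : C.IsBraidedCommutative) (a b : B) :
    C.leftData.target b * C.leftData.source a = C.leftData.source a * C.leftData.target b := by
  let F : B ⊗[k] (H ⊗[k] H) →ₗ[k] C.LeftSmash :=
    LinearMap.mul' k _ ∘ₗ TensorProduct.map C.leftData.source (LinearMap.mul' k _ ∘ₗ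
      TensorProduct.map (C.leftData.source ∘ₗ C.act a) C.leftOf)
  have h1 : ∀ z : B ⊗[k] H, C.toLeft z * C.leftData.source a =
      F ((Coalgebra.comul (R := k) (A := H)).lTensor B z) := fun z => by
    induction z with
    | zero => simp
    | add x y hx hy => simp only [map_add, add_mul, hx, hy]
    | tmul x y => simp [toLeft_tmul, mul_assoc, leftOf_mul_leftSource, F]
  have h2 : ∀ (z : B ⊗[k] H) (h : H), F (TensorProduct.assoc k B H H (z ⊗ₜ h)) =
      C.leftData.source (LinearMap.mul' k B ((C.act a).lTensor B z)) * C.leftOf h := fun z h => by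
    induction z with
    | zero => simp
    | add x y hx hy => simp only [map_add, TensorProduct.add_tmul, add_mul, hx, hy]
    | tmul x y => simp [leftSource_mul, mul_assoc, F]
  have h3 : ∀ z : B ⊗[k] H, F (TensorProduct.assoc k B H H (C.coact.toLinearMap.rTensor H z)) =
      C.leftData.source a * C.toLeft z := fun z => by
    induction z with
    | zero => simp
    | add x y hx hy => simp only [map_add, mul_add, hx, hy]
    | tmul x y =>
      rw [LinearMap.rTensor_tmul, h2, toLeft_tmul, ← mul_assoc, ← leftSource_mul]
      congr 2
      exact hC a x
  rw [leftTarget_apply, h1, ← C.coact_coassoc, h3]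

/-- As t(b) commutes with sources, left multiplication by t(b) in B # H^op is right multiplication
by b₀ ⊗ b₁ in the ordinary algebra B ⊗ H. There the coaction is an algebra map. -/
theorem IsBraidedCommutative.leftTarget_mul (hC : C.IsBraidedCommutative) (a b : B) :
    C.leftData.target (a * b) = C.leftData.target b * C.leftData.target a := by
  have h1 : ∀ (g : H) (z : B ⊗[k] H), C.toLeft z * C.leftOf g = C.toLeft ((1 ⊗ₜ g) * z) :=
    fun g z => by
    induction z with
    | zero => simp
    | add x y hx hy => simp only [map_add, add_mul, mul_add, hx, hy]
    | tmul x y => simp [toLeft_tmul, mul_assoc, leftOf_mul_leftOf]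
  have h2 : ∀ (c : B) (z : B ⊗[k] H), C.leftData.source c * C.toLeft z =
      C.toLeft ((c ⊗ₜ 1) * z) := fun c z => by
    induction z with
    | zero => simp
    | add x y hx hy => simp only [map_add, mul_add, hx, hy]
    | tmul x y => simp [leftSource_mul_toLeft]
  have h3 : ∀ z : B ⊗[k] H, C.leftData.target b * C.toLeft z = C.toLeft (z * C.coact b) :=
    fun z => by
    induction z with
    | zero => simp
    | add x y hx hy => simp only [map_add, mul_add, add_mul, hx, hy]
    | tmul x y =>
      rw [toLeft_tmul, ← mul_assoc, hC.leftTarget_mul_leftSource, mul_assoc, leftTarget_apply,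
        h1, h2, ← mul_assoc, Algebra.TensorProduct.tmul_mul_tmul, mul_one, one_mul]
  rw [C.leftTarget_apply a, h3, ← map_mul, leftTarget_apply]

theorem leftTarget_one : C.leftData.target 1 = 1 := by
  rw [leftTarget_apply, map_one]; rfl

/-! ## The coproduct and the counit of `B # H^op` -/

variable (C) in
theorem leftComulLift_source_mul (a : B) (X : C.LeftSmash) :
    C.leftComulLift (C.leftData.source a * X) =
      (C.leftData.source a ⊗ₜ 1) * C.leftComulLift X := by
  obtain ⟨z, rfl⟩ := C.toLeft.surjective X
  induction z with
  | zero => simp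
  | add x y hx hy => simp only [map_add, mul_add, hx, hy]
  | tmul b h =>
    rw [leftSource_mul_toLeft]
    simp only [leftComulLift, LinearMap.comp_apply, LinearEquiv.coe_coe,
      LinearEquiv.symm_apply_apply, LinearMap.lTensor_tmul]
    generalize Coalgebra.comul (R := k) h = w
    induction w with
    | zero => simp
    | add x y hx hy => simp only [map_add, mul_add, TensorProduct.tmul_add, hx, hy]
    | tmul x y => simp [leftSource_mul_toLeft]

variable (C) in
theorem leftComulLift_leftOf (h : H) :
    C.leftComulLift (C.leftOf h) =
      TensorProduct.map C.leftOf C.leftOf (Coalgebra.comul (R := k) h) := by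
  rw [leftOf_apply]
  simp only [leftComulLift, LinearMap.comp_apply, LinearEquiv.coe_coe,
    LinearEquiv.symm_apply_apply, LinearMap.lTensor_tmul]
  generalize Coalgebra.comul (R := k) h = w
  induction w with
  | zero => simp
  | add x y hx hy => simp only [map_add, TensorProduct.tmul_add, hx, hy]
  | tmul x y => rfl

variable (C) in
theorem leftComulLift_one : C.leftComulLift 1 = 1 := by
  rw [← leftOf_one, leftComulLift_leftOf, Bialgebra.comul_one, Algebra.TensorProduct.one_def]
  rfl

variable (C) in
theorem leftComulLift_source (a : B) :
    C.leftComulLift (C.leftData.source a) = C.leftData.source a ⊗ₜ 1 := by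
  have := C.leftComulLift_source_mul a 1
  rwa [mul_one, leftComulLift_one, mul_one] at this

variable (C) in
theorem leftComulLift_leftOf_mul_leftOf (h g : H) :
    C.leftComulLift (C.leftOf h * C.leftOf g) =
      C.leftComulLift (C.leftOf h) * C.leftComulLift (C.leftOf g) := by
  rw [leftOf_mul_leftOf]
  simp only [leftComulLift_leftOf]
  rw [Bialgebra.comul_mul]
  generalize Coalgebra.comul (R := k) h = z
  generalize Coalgebra.comul (R := k) g = w
  induction z with
  | zero => simp
  | add x y hx hy => simp only [map_add, mul_add, add_mul, hx, hy]
  | tmul x y =>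
  induction w with
  | zero => simp
  | add x y hx hy => simp only [map_add, mul_add, add_mul, hx, hy]
  | tmul x y => simp [leftOf_mul_leftOf]

variable (C) in
-- δ(s(b ◁ h₁) η(h₂)) = s(b ◁ h₁) η(h₂) ⊗ η(h₃) = η(h₁) s(b) ⊗ η(h₂): the lift respects the relation
-- between η and s before any balancing.
theorem leftComulLift_leftOf_mul_source (h : H) (b : B) :
    C.leftComulLift (C.leftOf h * C.leftData.source b) =
      C.leftComulLift (C.leftOf h) * (C.leftData.source b ⊗ₜ 1) := by
  let F : H ⊗[k] (H ⊗[k] H) →ₗ[k] C.LeftSmash ⊗[k] C.LeftSmash :=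
    LinearMap.mul' k _ ∘ₗ TensorProduct.map
      ((TensorProduct.mk k _ _).flip 1 ∘ₗ C.leftData.source ∘ₗ C.act b)
      (TensorProduct.map C.leftOf C.leftOf)
  have h1 : ∀ z : H ⊗[k] H, C.leftComulLift (LinearMap.mul' k _
      (TensorProduct.map (C.leftData.source ∘ₗ C.act b) C.leftOf z)) =
      F ((Coalgebra.comul (R := k) (A := H)).lTensor H z) := fun z => by
    induction z with
    | zero => simp
    | add x y hx hy => simp only [map_add, hx, hy]
    | tmul x y => simp [leftComulLift_source_mul, leftComulLift_leftOf, F]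
  have h2 : ∀ (z : H ⊗[k] H) (g : H), F (TensorProduct.assoc k H H H (z ⊗ₜ g)) =
      LinearMap.mul' k _ (TensorProduct.map (C.leftData.source ∘ₗ C.act b) C.leftOf z) ⊗ₜ
        C.leftOf g := fun z g => by
    induction z with
    | zero => simp
    | add x y hx hy => simp only [map_add, TensorProduct.add_tmul, hx, hy]
    | tmul x y => simp [F]
  have h3 : ∀ z : H ⊗[k] H, F (TensorProduct.assoc k H H H
      ((Coalgebra.comul (R := k) (A := H)).rTensor H z)) =
      TensorProduct.map C.leftOf C.leftOf z * (C.leftData.source b ⊗ₜ 1) := fun z => by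
    induction z with
    | zero => simp
    | add x y hx hy => simp only [map_add, add_mul, hx, hy]
    | tmul x y => rw [LinearMap.rTensor_tmul, h2, ← leftOf_mul_leftSource]; simp
  rw [leftOf_mul_leftSource, h1, ← Coalgebra.coassoc_apply, h3, leftComulLift_leftOf]

variable (C) in
-- Strict multiplicativity in the unbalanced tensor square. It suffices to multiply generators, and
-- the only nontrivial exchange is that of η(h) past s(b).
theorem leftComulLift_mul (X Y : C.LeftSmash) :
    C.leftComulLift (X * Y) = C.leftComulLift X * C.leftComulLift Y := by
  have h0 : ∀ X g, C.leftComulLift (X * C.leftOf g) =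
      C.leftComulLift X * C.leftComulLift (C.leftOf g) := fun X g => by
    induction X using C.leftSmash_induction with
    | zero => simp
    | add x y hx hy => simp only [map_add, add_mul, hx, hy]
    | source_mul_of a h =>
      rw [mul_assoc, leftComulLift_source_mul, leftComulLift_leftOf_mul_leftOf,
        leftComulLift_source_mul, mul_assoc]
  induction X using C.leftSmash_induction with
  | zero => simp
  | add x y hx hy => simp only [map_add, add_mul, hx, hy]
  | source_mul_of a h =>
  induction Y using C.leftSmash_induction with
  | zero => simp
  | add x y hx hy => simp only [map_add, mul_add, hx, hy]
  | source_mul_of b g =>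
    rw [← mul_assoc, h0, mul_assoc, leftComulLift_source_mul, leftComulLift_leftOf_mul_source,
      leftComulLift_source_mul, leftComulLift_source_mul]
    simp only [mul_assoc]

variable (C) in
theorem leftComulLift_coassoc (X : C.LeftSmash) :
    TensorProduct.assoc k _ _ _ (C.leftComulLift.rTensor _ (C.leftComulLift X)) =
      C.leftComulLift.lTensor _ (C.leftComulLift X) := by
  induction X using C.leftSmash_induction with
  | zero => simp
  | add x y hx hy => simp only [map_add, hx, hy]
  | source_mul_of a h =>
  let F : H ⊗[k] (H ⊗[k] H) →ₗ[k] C.LeftSmash ⊗[k] (C.LeftSmash ⊗[k] C.LeftSmash) :=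
    TensorProduct.map (LinearMap.mulLeft k (C.leftData.source a) ∘ₗ C.leftOf)
      (TensorProduct.map C.leftOf C.leftOf)
  rw [leftComulLift_source_mul, leftComulLift_leftOf]
  have h1 : ∀ z : H ⊗[k] H, C.leftComulLift.lTensor C.LeftSmash
      ((C.leftData.source a ⊗ₜ 1) * TensorProduct.map C.leftOf C.leftOf z) =
      F ((Coalgebra.comul (R := k) (A := H)).lTensor H z) := fun z => by
    induction z with
    | zero => simp
    | add x y hx hy => simp only [map_add, mul_add, hx, hy]
    | tmul x y => simp [leftComulLift_leftOf, F]
  have h2 : ∀ (z : H ⊗[k] H) (g : H), F (TensorProduct.assoc k H H H (z ⊗ₜ g)) =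
      TensorProduct.assoc k _ _ _ (((C.leftData.source a ⊗ₜ 1) *
        TensorProduct.map C.leftOf C.leftOf z) ⊗ₜ C.leftOf g) := fun z g => by
    induction z with
    | zero => simp
    | add x y hx hy => simp only [map_add, mul_add, TensorProduct.add_tmul, hx, hy]
    | tmul x y => simp [F]
  have h3 : ∀ z : H ⊗[k] H, TensorProduct.assoc k _ _ _ (C.leftComulLift.rTensor C.LeftSmash
      ((C.leftData.source a ⊗ₜ 1) * TensorProduct.map C.leftOf C.leftOf z)) =
      F (TensorProduct.assoc k H H H ((Coalgebra.comul (R := k) (A := H)).rTensor H z)) :=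
    fun z => by
    induction z with
    | zero => simp
    | add x y hx hy => simp only [map_add, mul_add, hx, hy]
    | tmul x y =>
      rw [LinearMap.rTensor_tmul, h2, ← leftComulLift_leftOf, ← leftComulLift_source_mul]
      simp
  rw [h1, h3, Coalgebra.coassoc_apply]

variable (C) in
theorem leftComul_apply (X : C.LeftSmash) :
    C.leftData.comul X = C.leftData.proj (C.leftComulLift X) := rfl

variable (C) in
-- s(b₀) η(b₁) ⊗ η(b₂) = t(b₀) ⊗ η(b₁) = 1 ⊗ s(b₀) η(b₁). The middle step uses the balancing, so the
-- identity is stated in the quotient.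
theorem leftComulLift_target (b : B) :
    C.leftData.proj (C.leftComulLift (C.leftData.target b)) =
      C.leftData.proj (1 ⊗ₜ C.leftData.target b) := by
  let F : B ⊗[k] (H ⊗[k] H) →ₗ[k] C.leftData.Square :=
    C.leftData.proj ∘ₗ LinearMap.mul' k _ ∘ₗ
      TensorProduct.map ((TensorProduct.mk k _ _).flip 1 ∘ₗ C.leftData.source)
        (TensorProduct.map C.leftOf C.leftOf)
  have h1 : ∀ z : B ⊗[k] H, C.leftData.proj (C.leftComulLift (C.toLeft z)) =
      F ((Coalgebra.comul (R := k) (A := H)).lTensor B z) := fun z => by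
    induction z with
    | zero => simp
    | add x y hx hy => simp only [map_add, hx, hy]
    | tmul x y => simp [toLeft_tmul, leftComulLift_source_mul, leftComulLift_leftOf, F]
  have h2 : ∀ (z : B ⊗[k] H) (g : H), F (TensorProduct.assoc k B H H (z ⊗ₜ g)) =
      C.leftData.proj (C.toLeft z ⊗ₜ C.leftOf g) := fun z g => by
    induction z with
    | zero => simp
    | add x y hx hy => simp only [map_add, TensorProduct.add_tmul, hx, hy]
    | tmul x y => simp [toLeft_tmul, F]
  have h3 : ∀ z : B ⊗[k] H, F (TensorProduct.assoc k B H H (C.coact.toLinearMap.rTensor H z)) =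
      C.leftData.proj (1 ⊗ₜ C.toLeft z) := fun z => by
    induction z with
    | zero => simp
    | add x y hx hy => simp only [map_add, TensorProduct.tmul_add, hx, hy]
    | tmul x y =>
      rw [LinearMap.rTensor_tmul, h2, toLeft_tmul, ← LeftBialgebroidData.proj_target_mul,
        mul_one]
      rfl
  rw [leftTarget_apply, h1, ← C.coact_coassoc, h3]

variable (C) in
theorem leftCounit_source_mul_leftOf (a : B) (h : H) :
    C.leftData.counit (C.leftData.source a * C.leftOf h) = Coalgebra.counit (R := k) h • a := by
  rw [← toLeft_tmul]
  simp [leftData]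

end Smash

/-! ### Takeuchi condition and counit of B # H^op -/

section LeftBialgebroid

variable {k H B : Type*} [CommRing k] [Ring H] [HopfAlgebra k H] [Ring B] [Algebra k B]
variable {C : CrossedModuleAlgebra k H B}

variable (C) in
-- Both sides equal t(b ◁ h₂) η(h₁) ⊗ η(h₃) in the balanced square: the left one by the relation
-- between η and t, the right one by moving s(b ◁ h₂) from the second factor to the first as a
-- target.
theorem leftComulLift_leftOf_takeuchi (b : B) (h : H) :
    C.leftData.proj (C.leftComulLift (C.leftOf h) * (C.leftData.target b ⊗ₜ 1)) =
      C.leftData.proj (C.leftComulLift (C.leftOf h) * (1 ⊗ₜ C.leftData.source b)) := by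
  let F : H ⊗[k] (H ⊗[k] H) →ₗ[k] C.leftData.Square :=
    C.leftData.proj ∘ₗ LinearMap.mul' k _ ∘ₗ
      TensorProduct.map ((TensorProduct.mk k _ _).flip 1 ∘ₗ C.leftData.target ∘ₗ C.act b)
        (TensorProduct.map C.leftOf C.leftOf) ∘ₗ (TensorProduct.leftComm k H H H).toLinearMap
  have h1 : ∀ (z : H ⊗[k] H) (g : H), F (TensorProduct.assoc k H H H (z ⊗ₜ g)) =
      C.leftData.proj (LinearMap.mul' k _
        (TensorProduct.map (C.leftData.target ∘ₗ C.act b) C.leftOf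
          (TensorProduct.comm k H H z)) ⊗ₜ C.leftOf g) := fun z g => by
    induction z with
    | zero => simp
    | add x y hx hy => simp only [map_add, TensorProduct.add_tmul, hx, hy]
    | tmul x y => simp [F]
  have h2 : ∀ (z : H ⊗[k] H) (g : H), F (g ⊗ₜ z) =
      C.leftData.proj (C.leftOf g ⊗ₜ LinearMap.mul' k _
        (TensorProduct.map (C.leftData.source ∘ₗ C.act b) C.leftOf z)) := fun z g => by
    induction z with
    | zero => simp
    | add x y hx hy => simp only [map_add, TensorProduct.tmul_add, hx, hy]
    | tmul x y =>
      rw [TensorProduct.map_tmul, LinearMap.mul'_apply]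
      refine Eq.trans ?_ (C.leftData.proj_target_mul (C.act b x) _ _)
      simp [F]
  have h3 : ∀ z : H ⊗[k] H, C.leftData.proj
      (TensorProduct.map C.leftOf C.leftOf z * (C.leftData.target b ⊗ₜ 1)) =
      F (TensorProduct.assoc k H H H ((Coalgebra.comul (R := k) (A := H)).rTensor H z)) :=
    fun z => by
    induction z with
    | zero => simp
    | add x y hx hy => simp only [map_add, add_mul, hx, hy]
    | tmul x y =>
      rw [LinearMap.rTensor_tmul, h1, ← leftOf_mul_leftTarget, TensorProduct.map_tmul,
        Algebra.TensorProduct.tmul_mul_tmul, mul_one]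
  have h4 : ∀ z : H ⊗[k] H, C.leftData.proj
      (TensorProduct.map C.leftOf C.leftOf z * (1 ⊗ₜ C.leftData.source b)) =
      F ((Coalgebra.comul (R := k) (A := H)).lTensor H z) :=
    fun z => by
    induction z with
    | zero => simp
    | add x y hx hy => simp only [map_add, add_mul, hx, hy]
    | tmul x y =>
      rw [LinearMap.lTensor_tmul, h2, ← leftOf_mul_leftSource, TensorProduct.map_tmul,
        Algebra.TensorProduct.tmul_mul_tmul, mul_one]
  rw [leftComulLift_leftOf, h3, h4, Coalgebra.coassoc_apply]

/-- Left multiplication by s(a) ⊗ 1 descends to the balanced square because s(a) commutes with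
targets, so the case of η(h) is enough. -/
theorem IsBraidedCommutative.leftComulLift_takeuchi (hC : C.IsBraidedCommutative) (b : B)
    (X : C.LeftSmash) :
    C.leftData.proj (C.leftComulLift X * (C.leftData.target b ⊗ₜ 1)) =
      C.leftData.proj (C.leftComulLift X * (1 ⊗ₜ C.leftData.source b)) := by
  induction X using C.leftSmash_induction with
  | zero => simp
  | add x y hx hy => simp only [map_add, add_mul, hx, hy]
  | source_mul_of a h =>
    rw [leftComulLift_source_mul, mul_assoc, mul_assoc]
    exact LeftBialgebroidData.proj_mul_left_tmul
      (fun b => (hC.leftTarget_mul_leftSource a b).symm) (fun b => by simp)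
      (C.leftComulLift_leftOf_takeuchi b h)

variable (C) in
theorem leftCounit_source_mul (a : B) (X : C.LeftSmash) :
    C.leftData.counit (C.leftData.source a * X) = a * C.leftData.counit X := by
  induction X using C.leftSmash_induction with
  | zero => simp
  | add x y hx hy => simp only [map_add, mul_add, hx, hy]
  | source_mul_of b h =>
    rw [← mul_assoc, ← leftSource_mul, leftCounit_source_mul_leftOf,
      leftCounit_source_mul_leftOf, mul_smul_comm]

variable (C) in
theorem leftCounit_leftOf (h : H) :
    C.leftData.counit (C.leftOf h) = Coalgebra.counit (R := k) h • (1 : B) := by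
  rw [← leftCounit_source_mul_leftOf, leftSource_one, one_mul]

variable (C) in
theorem leftCounit_mul_leftOf (X : C.LeftSmash) (g : H) :
    C.leftData.counit (X * C.leftOf g) = Coalgebra.counit (R := k) g • C.leftData.counit X := by
  induction X using C.leftSmash_induction with
  | zero => simp
  | add x y hx hy => simp only [map_add, add_mul, smul_add, hx, hy]
  | source_mul_of a h =>
    rw [mul_assoc, leftOf_mul_leftOf, leftCounit_source_mul_leftOf,
      leftCounit_source_mul_leftOf, Bialgebra.counit_mul, mul_smul]

variable (C) in
theorem leftCounit_target (b : B) : C.leftData.counit (C.leftData.target b) = b := by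
  conv_rhs => rw [← C.coact_counit b]
  rw [leftTarget_apply]
  rfl

theorem IsBraidedCommutative.leftCounit_target_mul (hC : C.IsBraidedCommutative) (b : B)
    (X : C.LeftSmash) :
    C.leftData.counit (C.leftData.target b * X) = C.leftData.counit X * b := by
  induction X using C.leftSmash_induction with
  | zero => simp
  | add x y hx hy => simp only [map_add, mul_add, add_mul, hx, hy]
  | source_mul_of a h =>
    rw [← mul_assoc, hC.leftTarget_mul_leftSource, leftCounit_mul_leftOf, leftCounit_source_mul,
      leftCounit_target, leftCounit_source_mul_leftOf, smul_mul_assoc]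

variable (C) in
-- The counit recovers the action. The same value arises with t(b) in place of s(b), which is why
-- the two counit axioms for products are equivalent here.
theorem leftCounit_leftOf_mul_source (h : H) (b : B) :
    C.leftData.counit (C.leftOf h * C.leftData.source b) = C.act b h := by
  have key : ∀ z : H ⊗[k] H, C.leftData.counit (LinearMap.mul' k _
      (TensorProduct.map (C.leftData.source ∘ₗ C.act b) C.leftOf z)) =
      C.act b (TensorProduct.rid k H ((Coalgebra.counit (R := k) (A := H)).lTensor H z)) :=
    fun z => by
    induction z with
    | zero => simp
    | add x y hx hy => simp only [map_add, hx, hy]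
    | tmul x y => simp [leftCounit_source_mul_leftOf]
  rw [leftOf_mul_leftSource, key, Coalgebra.lTensor_counit_comul, TensorProduct.rid_tmul, one_smul]

variable (C) in
theorem leftCounit_leftOf_mul_target (h : H) (b : B) :
    C.leftData.counit (C.leftOf h * C.leftData.target b) = C.act b h := by
  have key : ∀ z : H ⊗[k] H, C.leftData.counit (LinearMap.mul' k _
      (TensorProduct.map (C.leftData.target ∘ₗ C.act b) C.leftOf (TensorProduct.comm k H H z))) =
      C.act b (TensorProduct.lid k H ((Coalgebra.counit (R := k) (A := H)).rTensor H z)) :=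
    fun z => by
    induction z with
    | zero => simp
    | add x y hx hy => simp only [map_add, hx, hy]
    | tmul x y => simp [leftCounit_mul_leftOf, leftCounit_target]
  rw [leftOf_mul_leftTarget, key, Coalgebra.rTensor_counit_comul, TensorProduct.lid_tmul, one_smul]

variable (C) in
theorem leftCounit_mul_target (X : C.LeftSmash) (b : B) :
    C.leftData.counit (X * C.leftData.target b) = C.leftData.counit (X * C.leftData.source b) := by
  induction X using C.leftSmash_induction with
  | zero => simp
  | add x y hx hy => simp only [map_add, add_mul, hx, hy]
  | source_mul_of a h =>
    rw [mul_assoc, mul_assoc, leftCounit_source_mul, leftCounit_source_mul,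
      leftCounit_leftOf_mul_source, leftCounit_leftOf_mul_target]

variable (C) in
theorem leftCounit_mul_source (X Y : C.LeftSmash) :
    C.leftData.counit (X * Y) =
      C.leftData.counit (X * C.leftData.source (C.leftData.counit Y)) := by
  induction Y using C.leftSmash_induction with
  | zero => simp
  | add x y hx hy => simp only [map_add, mul_add, hx, hy]
  | source_mul_of b g =>
    rw [← mul_assoc, leftCounit_mul_leftOf, leftCounit_source_mul_leftOf, map_smul,
      mul_smul_comm, map_smul]

variable (C) in
theorem leftCounit_comul (X : C.LeftSmash) :
    LinearMap.mul' k _ ((C.leftData.source ∘ₗ C.leftData.counit).rTensor _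
      (C.leftComulLift X)) = X := by
  induction X using C.leftSmash_induction with
  | zero => simp
  | add x y hx hy => simp only [map_add, hx, hy]
  | source_mul_of a h =>
  have key : ∀ z : H ⊗[k] H, LinearMap.mul' k _
      ((C.leftData.source ∘ₗ C.leftData.counit).rTensor C.LeftSmash
      ((C.leftData.source a ⊗ₜ 1) * TensorProduct.map C.leftOf C.leftOf z)) =
      C.leftData.source a * C.leftOf (TensorProduct.lid k H
        ((Coalgebra.counit (R := k) (A := H)).rTensor H z)) := fun z => by
    induction z with
    | zero => simp
    | add x y hx hy => simp only [map_add, mul_add, hx, hy]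
    | tmul x y => simp [leftCounit_source_mul_leftOf]
  rw [leftComulLift_source_mul, leftComulLift_leftOf, key, Coalgebra.rTensor_counit_comul,
    TensorProduct.lid_tmul, one_smul]

variable (C) in
theorem leftComul_counit (X : C.LeftSmash) :
    LinearMap.mul' k _ ((C.leftData.target ∘ₗ C.leftData.counit).rTensor _
      (TensorProduct.comm k _ _ (C.leftComulLift X))) = X := by
  induction X using C.leftSmash_induction with
  | zero => simp
  | add x y hx hy => simp only [map_add, hx, hy]
  | source_mul_of a h =>
  have key : ∀ z : H ⊗[k] H, LinearMap.mul' k _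
      ((C.leftData.target ∘ₗ C.leftData.counit).rTensor C.LeftSmash
      (TensorProduct.comm k _ _
        ((C.leftData.source a ⊗ₜ 1) * TensorProduct.map C.leftOf C.leftOf z))) =
      C.leftData.source a * C.leftOf (TensorProduct.rid k H
        ((Coalgebra.counit (R := k) (A := H)).lTensor H z)) := fun z => by
    induction z with
    | zero => simp
    | add x y hx hy => simp only [map_add, mul_add, hx, hy]
    | tmul x y => simp [leftCounit_leftOf, leftTarget_one]
  rw [leftComulLift_source_mul, leftComulLift_leftOf, key, Coalgebra.lTensor_counit_comul,
    TensorProduct.rid_tmul, one_smul]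

/-- `B # H^op` is a left bialgebroid over `B`. -/
theorem IsBraidedCommutative.isLeftBialgebroid (hC : C.IsBraidedCommutative) :
    C.leftData.IsLeftBialgebroid :=
  LeftBialgebroidData.isLeftBialgebroid_of_lift C.leftComulLift C.leftComul_apply
    C.leftSource_one C.leftSource_mul leftTarget_one hC.leftTarget_mul
    (fun a b => (hC.leftTarget_mul_leftSource a b).symm) C.leftComulLift_source
    C.leftComulLift_target C.leftCounit_source_mul hC.leftCounit_target_mul
    C.leftComulLift_coassoc C.leftCounit_comul C.leftComul_counit hC.leftComulLift_takeuchi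
    C.leftComulLift_mul
    (by rw [← leftOf_one, leftCounit_leftOf, Bialgebra.counit_one, one_smul])
    C.leftCounit_mul_source
    (fun X Y => by rw [leftCounit_mul_target, ← leftCounit_mul_source])

end LeftBialgebroid

end CrossedModuleAlgebra

/-! ## Transport along reflexive maps -/

section BalancedCongr

variable {k A L R : Type*} [CommRing k] [AddCommGroup L] [Module k L] [AddCommGroup R] [Module k R]

theorem balancedRel_le_comap {p q : A → L → L} {p' q' : A → R → R} (Φ : L →ₗ[k] R)
    (hp : ∀ a x, Φ (p a x) = p' a (Φ x)) (hq : ∀ a x, Φ (q a x) = q' a (Φ x)) :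
    balancedRel k p q ≤ (balancedRel k p' q').comap (TensorProduct.map Φ Φ) := by
  refine Submodule.span_le.2 ?_
  rintro z ⟨a, x, y, rfl⟩
  refine Submodule.subset_span ⟨a, Φ x, Φ y, ?_⟩
  simp [hp, hq]

/-- A linear equivalence compatible with the actions induces an equivalence of balanced tensor
products. -/
def balancedCongr {p q : A → L → L} {p' q' : A → R → R} (Φ : L ≃ₗ[k] R)
    (hp : ∀ a x, Φ (p a x) = p' a (Φ x)) (hq : ∀ a x, Φ (q a x) = q' a (Φ x)) :
    BalancedTensor k p q ≃ₗ[k] BalancedTensor k p' q' :=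
  LinearEquiv.ofLinearMap
    ((balancedRel k p q).mapQ _ _ (balancedRel_le_comap Φ.toLinearMap hp hq))
    ((balancedRel k p' q').mapQ _ _ (balancedRel_le_comap Φ.symm.toLinearMap
      (fun a x => Φ.injective (by simp [hp])) (fun a x => Φ.injective (by simp [hq]))))
    (Submodule.linearMap_qext _ (TensorProduct.ext' fun x y => by simp))
    (Submodule.linearMap_qext _ (TensorProduct.ext' fun x y => by simp))

theorem balancedRel₃_le_comap {p q : A → L → L} {p' q' : A → R → R} (Φ : L →ₗ[k] R)
    (hp : ∀ a x, Φ (p a x) = p' a (Φ x)) (hq : ∀ a x, Φ (q a x) = q' a (Φ x)) :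
    balancedRel₃ k p q ≤
      (balancedRel₃ k p' q').comap (TensorProduct.map Φ (TensorProduct.map Φ Φ)) := by
  refine Submodule.span_le.2 ?_
  rintro z (⟨a, x, y, w, rfl⟩ | ⟨a, x, y, w, rfl⟩)
  · exact Submodule.subset_span (Or.inl ⟨a, Φ x, Φ y, Φ w, by simp [hp, hq]⟩)
  · exact Submodule.subset_span (Or.inr ⟨a, Φ x, Φ y, Φ w, by simp [hp, hq]⟩)

end BalancedCongr

/-! ### Right bialgebroid and Hopf axioms obtained through a reflexive map -/

namespace IsReflexive

variable {k A L R : Type*} [CommRing k] [Ring A] [Algebra k A] [Ring L] [Algebra k L]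
  [Ring R] [Algebra k R] {DL : LeftBialgebroidData k A L} {DR : RightBialgebroidData k A R}
  {Φ : L ≃ₗ[k] R}

theorem map_target_mul (h : IsReflexive DL DR Φ) (a : A) (x : L) :
    Φ (DL.target a * x) = Φ x * DR.source a := by rw [h.map_mul, h.map_target]

theorem map_source_mul (h : IsReflexive DL DR Φ) (a : A) (x : L) :
    Φ (DL.source a * x) = Φ x * DR.target a := by rw [h.map_mul, h.map_source]

theorem map_mul_target (h : IsReflexive DL DR Φ) (a : A) (x : L) :
    Φ (x * DL.target a) = DR.source a * Φ x := by rw [h.map_mul, h.map_target]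

theorem map_mul_source (h : IsReflexive DL DR Φ) (a : A) (x : L) :
    Φ (x * DL.source a) = DR.target a * Φ x := by rw [h.map_mul, h.map_source]

/-- The isomorphism `L ⊗_A L ≃ R ⊗_A R` induced by a reflexive map. -/
def square (h : IsReflexive DL DR Φ) : DL.Square ≃ₗ[k] DR.Square :=
  balancedCongr Φ h.map_target_mul h.map_source_mul

theorem square_proj (h : IsReflexive DL DR Φ) (u : L ⊗[k] L) :
    h.square (DL.proj u) = DR.proj (TensorProduct.map Φ.toLinearMap Φ.toLinearMap u) := rfl

theorem comul_map (h : IsReflexive DL DR Φ) (X : L) : DR.comul (Φ X) = h.square (DL.comul X) := by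
  obtain ⟨u, hu⟩ := Submodule.mkQ_surjective _ (DL.comul X)
  rw [h.map_comul X u hu, ← square_proj h, hu]

/-- Since Φ ⊗ Φ is surjective, every representative of a coproduct in R comes from a representative
of a coproduct in L. -/
theorem proj_map_iff (h : IsReflexive DL DR Φ) {X : L} {u : L ⊗[k] L} :
    DR.proj (TensorProduct.map Φ.toLinearMap Φ.toLinearMap u) = DR.comul (Φ X) ↔
      DL.proj u = DL.comul X := by
  rw [comul_map h, ← square_proj h, h.square.injective.eq_iff]

theorem map_tensor_mul (h : IsReflexive DL DR Φ) (u v : L ⊗[k] L) :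
    TensorProduct.map Φ.toLinearMap Φ.toLinearMap (u * v) =
      TensorProduct.map Φ.toLinearMap Φ.toLinearMap v *
        TensorProduct.map Φ.toLinearMap Φ.toLinearMap u := by
  induction u with
  | zero => simp
  | add x y hx hy => simp only [map_add, add_mul, mul_add, hx, hy]
  | tmul x y =>
  induction v with
  | zero => simp
  | add x y hx hy => simp only [map_add, add_mul, mul_add, hx, hy]
  | tmul x y => simp [h.map_mul]

theorem tensor_surjective (Φ : L ≃ₗ[k] R) :
    Function.Surjective (TensorProduct.map Φ.toLinearMap Φ.toLinearMap) :=
  TensorProduct.map_surjective Φ.surjective Φ.surjective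

theorem joinLeft_comul (h : IsReflexive DL DR Φ) (u : L ⊗[k] L) :
    joinLeft (k := k) _ _ (DR.comul.rTensor R (TensorProduct.map Φ.toLinearMap Φ.toLinearMap u)) =
      (balancedRel₃ k _ _).mapQ _ _
        (balancedRel₃_le_comap Φ.toLinearMap h.map_target_mul h.map_source_mul)
        (joinLeft (k := k) _ _ (DL.comul.rTensor L u)) := by
  induction u with
  | zero => simp
  | add x y hx hy => simp only [map_add, hx, hy]
  | tmul x y =>
    rw [TensorProduct.map_tmul, LinearMap.rTensor_tmul, LinearMap.rTensor_tmul,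
      LinearEquiv.coe_coe, comul_map h]
    obtain ⟨w, hw⟩ := Submodule.mkQ_surjective _ (DL.comul x)
    have key : TensorProduct.assoc k R R R
        (TensorProduct.map Φ.toLinearMap Φ.toLinearMap w ⊗ₜ Φ y) =
        TensorProduct.map Φ.toLinearMap (TensorProduct.map Φ.toLinearMap Φ.toLinearMap)
          (TensorProduct.assoc k L L L (w ⊗ₜ y)) := by
      clear hw
      induction w with
      | zero => simp
      | add x y hx hy => simp only [map_add, TensorProduct.add_tmul, hx, hy]
      | tmul x y => simp
    rw [← hw, square_proj, joinLeft_mk, joinLeft_mk]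
    exact congrArg (balancedRel₃ k _ _).mkQ key

theorem joinRight_comul (h : IsReflexive DL DR Φ) (u : L ⊗[k] L) :
    joinRight (k := k) _ _ (DR.comul.lTensor R (TensorProduct.map Φ.toLinearMap Φ.toLinearMap u)) =
      (balancedRel₃ k _ _).mapQ _ _
        (balancedRel₃_le_comap Φ.toLinearMap h.map_target_mul h.map_source_mul)
        (joinRight (k := k) _ _ (DL.comul.lTensor L u)) := by
  induction u with
  | zero => simp
  | add x y hx hy => simp only [map_add, hx, hy]
  | tmul x y =>
    rw [TensorProduct.map_tmul, LinearMap.lTensor_tmul, LinearMap.lTensor_tmul,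
      LinearEquiv.coe_coe, comul_map h]
    obtain ⟨w, hw⟩ := Submodule.mkQ_surjective _ (DL.comul y)
    rw [← hw, square_proj, joinRight_mk, joinRight_mk]
    rfl

theorem counit_comul (h : IsReflexive DL DR Φ) (u : L ⊗[k] L) :
    LinearMap.mul' k R ((DR.target ∘ₗ DR.counit).lTensor R (TensorProduct.comm k R R
      (TensorProduct.map Φ.toLinearMap Φ.toLinearMap u))) =
      Φ (LinearMap.mul' k L ((DL.source ∘ₗ DL.counit).rTensor L u)) := by
  induction u with
  | zero => simp
  | add x y hx hy => simp only [map_add, hx, hy]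
  | tmul x y => simp [h.map_mul, h.map_source, h.map_counit]

theorem comul_counit (h : IsReflexive DL DR Φ) (u : L ⊗[k] L) :
    LinearMap.mul' k R ((DR.source ∘ₗ DR.counit).lTensor R
      (TensorProduct.map Φ.toLinearMap Φ.toLinearMap u)) =
      Φ (LinearMap.mul' k L ((DL.target ∘ₗ DL.counit).rTensor L
        (TensorProduct.comm k L L u))) := by
  induction u with
  | zero => simp
  | add x y hx hy => simp only [map_add, hx, hy]
  | tmul x y => simp [h.map_mul, h.map_target, h.map_counit]

/-- The partner of a left bialgebroid in a reflexive pair is a right bialgebroid. -/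
theorem isRightBialgebroid (h : IsReflexive DL DR Φ) (hL : DL.IsLeftBialgebroid) :
    DR.IsRightBialgebroid where
  -- Each axiom is the image of a left axiom. Source and target trade places, and products are
  -- reversed, so multiplications change sides.
  source_one := by rw [← h.map_target, hL.target_one, h.map_one]
  source_mul a b := by simp only [← h.map_target, hL.target_mul, h.map_mul]
  target_one := by rw [← h.map_source, hL.source_one, h.map_one]
  target_mul a b := by simp only [← h.map_source, hL.source_mul, h.map_mul]
  source_target_comm a b := by
    rw [← h.map_target, ← h.map_source, ← h.map_mul, ← h.map_mul, hL.source_target_comm]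
  comul_mul_target a X u hu := by
    obtain ⟨X, rfl⟩ := Φ.surjective X
    obtain ⟨u, rfl⟩ := tensor_surjective Φ u
    rw [← h.map_source_mul, h.map_comul _ _ (hL.comul_source_mul a X u
      (h.proj_map_iff.1 hu)).symm, h.map_tensor_mul, TensorProduct.map_tmul]
    simp only [LinearEquiv.coe_coe, h.map_source, h.map_one]
  comul_mul_source a X u hu := by
    obtain ⟨X, rfl⟩ := Φ.surjective X
    obtain ⟨u, rfl⟩ := tensor_surjective Φ u
    rw [← h.map_target_mul, h.map_comul _ _ (hL.comul_target_mul a X u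
      (h.proj_map_iff.1 hu)).symm, h.map_tensor_mul, TensorProduct.map_tmul]
    simp only [LinearEquiv.coe_coe, h.map_target, h.map_one]
  counit_mul_target a X := by
    obtain ⟨X, rfl⟩ := Φ.surjective X
    rw [← h.map_source_mul, h.map_counit, h.map_counit, hL.counit_source_mul]
  counit_mul_source a X := by
    obtain ⟨X, rfl⟩ := Φ.surjective X
    rw [← h.map_target_mul, h.map_counit, h.map_counit, hL.counit_target_mul]
  coassoc X u hu := by
    obtain ⟨X, rfl⟩ := Φ.surjective X
    obtain ⟨u, rfl⟩ := tensor_surjective Φ u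
    rw [h.joinLeft_comul, h.joinRight_comul, hL.coassoc X u (h.proj_map_iff.1 hu)]
  counit_comul X u hu := by
    obtain ⟨X, rfl⟩ := Φ.surjective X
    obtain ⟨u, rfl⟩ := tensor_surjective Φ u
    rw [h.counit_comul, hL.counit_comul X u (h.proj_map_iff.1 hu)]
  comul_counit X u hu := by
    obtain ⟨X, rfl⟩ := Φ.surjective X
    obtain ⟨u, rfl⟩ := tensor_surjective Φ u
    rw [h.comul_counit, hL.comul_counit X u (h.proj_map_iff.1 hu)]
  takeuchi a X u hu := by
    obtain ⟨X, rfl⟩ := Φ.surjective X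
    obtain ⟨u, rfl⟩ := tensor_surjective Φ u
    have := congrArg h.square (hL.takeuchi a X u (h.proj_map_iff.1 hu))
    rw [h.square_proj, h.square_proj, h.map_tensor_mul, h.map_tensor_mul] at this
    simpa only [TensorProduct.map_tmul, LinearEquiv.coe_coe, h.map_source, h.map_target,
      h.map_one] using this
  comul_one := by
    rw [← h.map_one, h.map_comul 1 _ hL.comul_one.symm]
    rfl
  comul_mul X Y u v hu hv := by
    obtain ⟨X, rfl⟩ := Φ.surjective X
    obtain ⟨u, rfl⟩ := tensor_surjective Φ u
    obtain ⟨Y, rfl⟩ := Φ.surjective Y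
    obtain ⟨v, rfl⟩ := tensor_surjective Φ v
    rw [← h.map_mul, ← h.map_tensor_mul]
    exact h.map_comul _ _ (hL.comul_mul Y X v u (h.proj_map_iff.1 hv) (h.proj_map_iff.1 hu)).symm
  counit_one := by rw [← h.map_one, h.map_counit, hL.counit_one]
  counit_source_mul X Y := by
    obtain ⟨X, rfl⟩ := Φ.surjective X
    obtain ⟨Y, rfl⟩ := Φ.surjective Y
    rw [← h.map_mul_target, ← h.map_mul, h.map_counit, h.map_counit, h.map_counit,
      hL.counit_mul_target]
  counit_target_mul X Y := by
    obtain ⟨X, rfl⟩ := Φ.surjective X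
    obtain ⟨Y, rfl⟩ := Φ.surjective Y
    rw [← h.map_mul_source, ← h.map_mul, h.map_counit, h.map_counit, h.map_counit,
      hL.counit_mul_source]

/-- The partner of a left Hopf algebroid in a reflexive pair is anti-right Hopf. -/
theorem isAntiRightHopf (h : IsReflexive DL DR Φ) (hL : DL.IsLeftHopf) : DR.IsAntiRightHopf := by
  obtain ⟨e, he⟩ := hL
  -- Φ turns the relation X t(a) ⊗ Y = X ⊗ t(a) Y into s(a) X ⊗ Y = X ⊗ Y s(a), and X₁ ⊗ X₂ Y into
  -- X₁ ⊗ Y X₂.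
  let c : DL.OpSquare ≃ₗ[k] DR.UpperSquare := balancedCongr Φ h.map_mul_target h.map_target_mul
  refine ⟨c.symm ≪≫ₗ e ≪≫ₗ h.square, fun X Y u hu => ?_⟩
  obtain ⟨X, rfl⟩ := Φ.surjective X
  obtain ⟨Y, rfl⟩ := Φ.surjective Y
  obtain ⟨u, rfl⟩ := tensor_surjective Φ u
  have hc : c.symm (Submodule.Quotient.mk (Φ X ⊗ₜ Φ Y)) = Submodule.Quotient.mk (X ⊗ₜ Y) :=
    c.symm_apply_eq.2 rfl
  rw [LinearEquiv.trans_apply, LinearEquiv.trans_apply, hc, he X Y u (h.proj_map_iff.1 hu),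
    h.square_proj, h.map_tensor_mul, TensorProduct.map_tmul, LinearEquiv.coe_coe, h.map_one]

/-- The partner of an anti-left Hopf algebroid in a reflexive pair is right Hopf. -/
theorem isRightHopf (h : IsReflexive DL DR Φ) (hL : DL.IsAntiLeftHopf) : DR.IsRightHopf := by
  obtain ⟨e, he⟩ := hL
  let c : DL.UpperSquare ≃ₗ[k] DR.OpSquare := balancedCongr Φ h.map_source_mul h.map_mul_source
  refine ⟨c.symm ≪≫ₗ e ≪≫ₗ h.square, fun X Y u hu => ?_⟩
  obtain ⟨X, rfl⟩ := Φ.surjective X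
  obtain ⟨Y, rfl⟩ := Φ.surjective Y
  obtain ⟨u, rfl⟩ := tensor_surjective Φ u
  have hc : c.symm (Submodule.Quotient.mk (Φ X ⊗ₜ Φ Y)) = Submodule.Quotient.mk (X ⊗ₜ Y) :=
    c.symm_apply_eq.2 rfl
  rw [LinearEquiv.trans_apply, LinearEquiv.trans_apply, hc, he X Y u (h.proj_map_iff.1 hu),
    h.square_proj, h.map_tensor_mul, TensorProduct.map_tmul, LinearEquiv.coe_coe, h.map_one]

end IsReflexive

/-! ## Twisting by right actions of a Hopf algebra -/

section TwistEquiv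

variable {k H V M : Type*} [CommRing k] [Ring H] [HopfAlgebra k H]
  [AddCommGroup V] [Module k V] [AddCommGroup M] [Module k M]

/-- For a right `H`-comodule `V` and a right `H`-module `M`, the bijection
`v ⊗ m ↦ v₀ ⊗ m v₁` with inverse `v ⊗ m ↦ v₀ ⊗ m S⁻¹(v₁)`. -/
def twistEquiv (hS : Function.Bijective (HopfAlgebra.antipode k (A := H)))
    (δ : V →ₗ[k] V ⊗[k] H)
    (hδ : ∀ v, TensorProduct.assoc k V H H (δ.rTensor H (δ v)) =
      (Coalgebra.comul (R := k) (A := H)).lTensor V (δ v))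
    (hε : ∀ v, TensorProduct.rid k V ((Coalgebra.counit (R := k) (A := H)).lTensor V (δ v)) = v)
    (α : M →ₗ[k] H →ₗ[k] M) (α_one : ∀ m, α m 1 = m)
    (α_mul : ∀ m h g, α m (h * g) = α (α m h) g) : V ⊗[k] M ≃ₗ[k] V ⊗[k] M :=
  LinearEquiv.ofLinearMap (twist δ α.flip) (twist δ (α.compl₂ (antipodeInv hS)).flip)
    (LinearMap.ext <| twist_twist hδ hε fun x m => by
      have key : ∀ z : H ⊗[k] H, TensorProduct.lift
          (α.flip.compl₂ ((α.compl₂ (antipodeInv hS)).flip.flip m)) z =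
          α m (LinearMap.mul' k H ((antipodeInv hS).rTensor H (TensorProduct.comm k H H z))) :=
        fun z => by
        induction z with
        | zero => simp
        | add x y hx hy => simp only [map_add, hx, hy]
        | tmul x y => simp [α_mul]
      rw [key, mul_antipodeInv_comm_comul, map_smul, α_one])
    (LinearMap.ext <| twist_twist hδ hε fun x m => by
      have key : ∀ z : H ⊗[k] H, TensorProduct.lift
          ((α.compl₂ (antipodeInv hS)).flip.compl₂ (α.flip.flip m)) z =
          α m (LinearMap.mul' k H ((antipodeInv hS).lTensor H (TensorProduct.comm k H H z))) :=
        fun z => by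
        induction z with
        | zero => simp
        | add x y hx hy => simp only [map_add, hx, hy]
        | tmul x y => simp [α_mul]
      rw [key, mul_antipodeInv_comm_comul', map_smul, α_one])

/-- For a left `H`-comodule `V` and a right `H`-module `M`, the bijection
`m ⊗ v ↦ m v₋₁ ⊗ v₀` with inverse `m ⊗ v ↦ m S(v₋₁) ⊗ v₀`. -/
def twistLeftEquiv (δ : V →ₗ[k] H ⊗[k] V)
    (hδ : ∀ v, TensorProduct.assoc k H H V
      ((Coalgebra.comul (R := k) (A := H)).rTensor V (δ v)) = δ.lTensor H (δ v))
    (hε : ∀ v, TensorProduct.lid k V ((Coalgebra.counit (R := k) (A := H)).rTensor V (δ v)) = v)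
    (α : M →ₗ[k] H →ₗ[k] M) (α_one : ∀ m, α m 1 = m)
    (α_mul : ∀ m h g, α m (h * g) = α (α m h) g) : M ⊗[k] V ≃ₗ[k] M ⊗[k] V :=
  LinearEquiv.ofLinearMap (twistLeft δ α.flip)
    (twistLeft δ (α.compl₂ (HopfAlgebra.antipode k)).flip)
    (LinearMap.ext <| twistLeft_twistLeft hδ hε fun x m => by
      have key : ∀ z : H ⊗[k] H, TensorProduct.lift
          (α.flip.compl₂ ((α.compl₂ (HopfAlgebra.antipode k)).flip.flip m))
            (TensorProduct.comm k H H z) =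
          α m (LinearMap.mul' k H ((HopfAlgebra.antipode k).rTensor H z)) := fun z => by
        induction z with
        | zero => simp
        | add x y hx hy => simp only [map_add, hx, hy]
        | tmul x y => simp [α_mul]
      rw [key, HopfAlgebra.mul_antipode_rTensor_comul_apply, Algebra.algebraMap_eq_smul_one,
        map_smul, α_one])
    (LinearMap.ext <| twistLeft_twistLeft hδ hε fun x m => by
      have key : ∀ z : H ⊗[k] H, TensorProduct.lift
          ((α.compl₂ (HopfAlgebra.antipode k)).flip.compl₂ (α.flip.flip m))
            (TensorProduct.comm k H H z) =
          α m (LinearMap.mul' k H ((HopfAlgebra.antipode k).lTensor H z)) := fun z => by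
        induction z with
        | zero => simp
        | add x y hx hy => simp only [map_add, hx, hy]
        | tmul x y => simp [α_mul]
      rw [key, HopfAlgebra.mul_antipode_lTensor_comul_apply, Algebra.algebraMap_eq_smul_one,
        map_smul, α_one])

end TwistEquiv

namespace CrossedModuleAlgebra

variable {k H B : Type*} [CommRing k] [Ring H] [HopfAlgebra k H] [Ring B] [Algebra k B]
variable (C : CrossedModuleAlgebra k H B)

theorem toRight_mul_toRight (x y : H ⊗[k] B) :
    C.toRight x * C.toRight y = C.toRight (C.rightMul x y) := rfl

variable (hS : Function.Bijective (HopfAlgebra.antipode k (A := H)))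

theorem toRight_tmul (h : H) (a : B) :
    C.toRight (h ⊗ₜ a) = C.toRight (h ⊗ₜ 1) * (C.rightData hS).source a := by
  refine Eq.symm ?_
  change C.toRight (h ⊗ₜ 1) * C.toRight (1 ⊗ₜ a) = _
  rw [toRight_mul_toRight, rightMul_tmul, Bialgebra.comul_one, Algebra.TensorProduct.one_def]
  simp [C.act_one]

/-! ## The reflexive map -/

/-- The map `Φ(a ⊗ h) = h S⁻¹(a₁) ⊗ a₀` from `B # H^op` to `H # B`. -/
def reflexiveMap : C.LeftSmash ≃ₗ[k] C.RightSmash :=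
  C.toLeft.symm ≪≫ₗ
    -- The twist of the coaction by right multiplication on H sends a ⊗ h to a₀ ⊗ h a₁; up to the
    -- flip this is Φ⁻¹, so Φ is built from its inverse.
    (twistEquiv hS C.coact.toLinearMap C.coact_coassoc C.coact_counit (LinearMap.mul k H)
      mul_one (fun m h g => (mul_assoc m h g).symm)).symm ≪≫ₗ
    TensorProduct.comm k B H ≪≫ₗ C.toRight

theorem reflexiveMap_toLeft (a : B) (h : H) :
    C.reflexiveMap hS (C.toLeft (a ⊗ₜ h)) = C.toRight (TensorProduct.comm k B H
      ((LinearMap.mulLeft k h ∘ₗ antipodeInv hS).lTensor B (C.coact a))) := by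
  refine congrArg (fun z => C.toRight (TensorProduct.comm k B H z)) ?_
  exact twist_tmul _ _ a h

theorem reflexiveMap_symm_toRight (h : H) (a : B) :
    (C.reflexiveMap hS).symm (C.toRight (h ⊗ₜ a)) =
      C.toLeft ((LinearMap.mulLeft k h).lTensor B (C.coact a)) :=
  congrArg C.toLeft (twist_tmul _ _ a h)

/-- s(a₀) η(h a₁) = s(a₀) η(a₁) η(h). In this form the properties of Φ become relations between t
and η. -/
theorem reflexiveMap_symm_toRight' (h : H) (a : B) :
    (C.reflexiveMap hS).symm (C.toRight (h ⊗ₜ a)) = C.leftData.target a * C.leftOf h := by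
  rw [reflexiveMap_symm_toRight, leftTarget_apply]
  generalize C.coact a = z
  induction z with
  | zero => simp
  | add x y hx hy => simp only [map_add, add_mul, hx, hy]
  | tmul x y => simp [toLeft_tmul, mul_assoc, leftOf_mul_leftOf]

theorem reflexiveMap_target_mul_leftOf (h : H) (a : B) :
    C.reflexiveMap hS (C.leftData.target a * C.leftOf h) = C.toRight (h ⊗ₜ a) := by
  rw [← C.reflexiveMap_symm_toRight' hS, LinearEquiv.apply_symm_apply]

theorem reflexiveMap_leftOf (h : H) :
    C.reflexiveMap hS (C.leftOf h) = C.toRight (h ⊗ₜ 1) := by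
  rw [← reflexiveMap_target_mul_leftOf, leftTarget_one, one_mul]

theorem reflexiveMap_target (a : B) :
    C.reflexiveMap hS (C.leftData.target a) = (C.rightData hS).source a := by
  rw [← mul_one (C.leftData.target a), ← leftOf_one, reflexiveMap_target_mul_leftOf]
  rfl

theorem reflexiveMap_source (a : B) :
    C.reflexiveMap hS (C.leftData.source a) = (C.rightData hS).target a := by
  rw [leftSource_apply, reflexiveMap_toLeft, LinearMap.mulLeft_one]
  rfl

variable {C}

/-- The product h g₁ ⊗ (a ◁ g₂) b is sent to t(b) t(a ◁ g₂) η(g₁) η(h), which the relation between η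
and t turns into t(b) η(g) t(a) η(h). -/
theorem IsBraidedCommutative.reflexiveMap_symm_mul (hC : C.IsBraidedCommutative)
    (X Y : C.RightSmash) :
    (C.reflexiveMap hS).symm (X * Y) =
      (C.reflexiveMap hS).symm Y * (C.reflexiveMap hS).symm X := by
  obtain ⟨x, rfl⟩ := C.toRight.surjective X
  obtain ⟨y, rfl⟩ := C.toRight.surjective Y
  induction x with
  | zero => simp
  | add x y hx hy => simp only [map_add, add_mul, mul_add, hx, hy]
  | tmul h a =>
  induction y with
  | zero => simp
  | add x y hx hy => simp only [map_add, add_mul, mul_add, hx, hy]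
  | tmul g b =>
  have key : ∀ z : H ⊗[k] H, (C.reflexiveMap hS).symm (C.toRight
      (TensorProduct.map (LinearMap.mul k H h) ((LinearMap.mul k B).flip b ∘ₗ C.act a) z)) =
      C.leftData.target b * (LinearMap.mul' k _
        (TensorProduct.map (C.leftData.target ∘ₗ C.act a) C.leftOf
          (TensorProduct.comm k H H z)) * C.leftOf h) := fun z => by
    induction z with
    | zero => simp
    | add x y hx hy => simp only [map_add, add_mul, mul_add, hx, hy]
    | tmul x y =>
      simp [reflexiveMap_symm_toRight', hC.leftTarget_mul, mul_assoc, leftOf_mul_leftOf]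
  rw [toRight_mul_toRight, rightMul_tmul, key, ← leftOf_mul_leftTarget,
    reflexiveMap_symm_toRight', reflexiveMap_symm_toRight']
  simp only [mul_assoc]

theorem IsBraidedCommutative.reflexiveMap_mul (hC : C.IsBraidedCommutative)
    (X Y : C.LeftSmash) :
    C.reflexiveMap hS (X * Y) = C.reflexiveMap hS Y * C.reflexiveMap hS X := by
  apply (C.reflexiveMap hS).symm.injective
  rw [hC.reflexiveMap_symm_mul]
  simp only [LinearEquiv.symm_apply_apply]

/-- `Φ` makes `(B # H^op, H # B)` a reflexive pair. -/
theorem IsBraidedCommutative.isReflexive (hC : C.IsBraidedCommutative) :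
    IsReflexive C.leftData (C.rightData hS) (C.reflexiveMap hS) where
  map_one := by
    rw [← leftOf_one, reflexiveMap_leftOf]
    rfl
  map_mul := hC.reflexiveMap_mul hS
  map_source := C.reflexiveMap_source hS
  map_target := C.reflexiveMap_target hS
  map_comul X u hu := by
    have hcongr : ∀ u v, C.leftData.proj u = C.leftData.proj v →
        (C.rightData hS).proj (TensorProduct.map (C.reflexiveMap hS).toLinearMap
          (C.reflexiveMap hS).toLinearMap u) =
        (C.rightData hS).proj (TensorProduct.map (C.reflexiveMap hS).toLinearMap
          (C.reflexiveMap hS).toLinearMap v) := fun u v huv => by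
      refine LeftBialgebroidData.proj_congr ((C.rightData hS).proj ∘ₗ TensorProduct.map
        (C.reflexiveMap hS).toLinearMap (C.reflexiveMap hS).toLinearMap) (fun a x y => ?_) huv
      simp only [LinearMap.comp_apply, TensorProduct.map_tmul, LinearEquiv.coe_coe,
        hC.reflexiveMap_mul, reflexiveMap_source, reflexiveMap_target]
      exact balanced_tmul (fun a x => x * (C.rightData hS).source a)
        (fun a y => y * (C.rightData hS).target a) a _ _
    rw [hcongr u (C.leftComulLift X) hu]
    clear hu
    obtain ⟨Z, rfl⟩ := (C.reflexiveMap hS).symm.surjective X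
    obtain ⟨z, rfl⟩ := C.toRight.surjective Z
    rw [LinearEquiv.apply_symm_apply]
    induction z with
    | zero => simp
    | add x y hx hy => simp only [map_add, hx, hy]
    | tmul h a =>
      -- In the balanced square, Δ(t(a) η(h)) = η(h₁) ⊗ t(a) η(h₂). Applying Φ to both factors gives
      -- (h₁ ⊗ 1) ⊗ (h₂ ⊗ a) on the nose.
      have h1 : C.leftData.proj (C.leftComulLift ((C.reflexiveMap hS).symm
          (C.toRight (h ⊗ₜ a)))) = C.leftData.proj ((1 ⊗ₜ C.leftData.target a) *
            TensorProduct.map C.leftOf C.leftOf (Coalgebra.comul (R := k) h)) := by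
        rw [reflexiveMap_symm_toRight', ← leftComulLift_leftOf]
        exact hC.isLeftBialgebroid.comul_target_mul a _ _ rfl
      rw [hcongr _ _ h1]
      refine congrArg (C.rightData hS).proj ?_
      simp only [rightComulLift, LinearMap.comp_apply, LinearEquiv.coe_coe,
        LinearEquiv.symm_apply_apply, LinearMap.rTensor_tmul]
      generalize Coalgebra.comul (R := k) h = w
      induction w with
      | zero => simp
      | add x y hx hy => simp only [map_add, mul_add, TensorProduct.add_tmul, hx, hy]
      | tmul x y => simp [reflexiveMap_leftOf, reflexiveMap_target_mul_leftOf]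
  map_counit X := by
    obtain ⟨Z, rfl⟩ := (C.reflexiveMap hS).symm.surjective X
    obtain ⟨z, rfl⟩ := C.toRight.surjective Z
    rw [LinearEquiv.apply_symm_apply]
    induction z with
    | zero => simp
    | add x y hx hy => simp only [map_add, hx, hy]
    | tmul h a =>
      rw [reflexiveMap_symm_toRight', leftCounit_mul_leftOf, leftCounit_target]
      simp [rightData]

/-! ## The Hopf conditions -/

section Hopf

variable {k H B : Type*} [CommRing k] [Ring H] [HopfAlgebra k H] [Ring B] [Algebra k B]
variable {C : CrossedModuleAlgebra k H B}

variable (C) in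
/-- The right action `X ↦ (1 ⊗ h) X` of `H` on `B # H^op`. -/
def leftOfAction : C.LeftSmash →ₗ[k] H →ₗ[k] C.LeftSmash :=
  (LinearMap.mul k C.LeftSmash ∘ₗ C.leftOf).flip

variable (C) in
theorem leftOfAction_apply (X : C.LeftSmash) (h : H) : C.leftOfAction X h = C.leftOf h * X := rfl

variable (C) in
theorem leftOfAction_one (X : C.LeftSmash) : C.leftOfAction X 1 = X := by
  rw [leftOfAction_apply, leftOf_one, one_mul]

variable (C) in
theorem leftOfAction_mul (X : C.LeftSmash) (h g : H) :
    C.leftOfAction X (h * g) = C.leftOfAction (C.leftOfAction X h) g := by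
  simp only [leftOfAction_apply, ← mul_assoc, leftOf_mul_leftOf]

/-- The basis t(a) η(h) identifies the target of the Hopf map with H ⊗ L, and the basis η(h) t(a)
does so for its domain. Between these coordinates the map is the twist h ⊗ Y ↦ h₁ ⊗ η(h₂) Y, which
is invertible through S⁻¹. -/
theorem IsBraidedCommutative.isLeftHopf (hC : C.IsBraidedCommutative)
    (hS : Function.Bijective (HopfAlgebra.antipode k (A := H))) : C.leftData.IsLeftHopf := by
  have hε : ∀ h : H, TensorProduct.rid k H ((Coalgebra.counit (R := k) (A := H)).lTensor H
      (Coalgebra.comul (R := k) h)) = h := fun h => by simp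
  -- `h ⊗ a ↦ t(a) (1 ⊗ h)` and `h ⊗ a ↦ (1 ⊗ h) t(a)`
  let ψ : H ⊗[k] B ≃ₗ[k] C.LeftSmash := C.toRight ≪≫ₗ (C.reflexiveMap hS).symm
  have hψ : ∀ h a, ψ (h ⊗ₜ a) = C.leftData.target a * C.leftOf h :=
    C.reflexiveMap_symm_toRight' hS
  -- Since η(h) t(a) = t(a ◁ h₂) η(h₁), the two bases differ by the invertible twist h ⊗ a ↦ h₁ ⊗ (a
  -- ◁ h₂).
  let ψ' : H ⊗[k] B ≃ₗ[k] C.LeftSmash :=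
    twistEquiv hS Coalgebra.comul Coalgebra.coassoc_apply hε C.act C.act_one C.act_mul ≪≫ₗ ψ
  have hψ' : ∀ h a, ψ' (h ⊗ₜ a) = C.leftOf h * C.leftData.target a := fun h a => by
    have key : ∀ z : H ⊗[k] H, ψ ((C.act a).lTensor H z) = LinearMap.mul' k _
        (TensorProduct.map (C.leftData.target ∘ₗ C.act a) C.leftOf
          (TensorProduct.comm k H H z)) := fun z => by
      induction z with
      | zero => simp
      | add x y hx hy => simp only [map_add, hx, hy]
      | tmul x y => simp [hψ]
    rw [leftOf_mul_leftTarget, ← key]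
    exact congrArg ψ (twist_tmul _ _ h a)
  obtain ⟨e₁, he₁⟩ := exists_equiv_balancedTensor_left
    (p := fun (a : B) x => C.leftData.target a * x) (q := fun (a : B) y => C.leftData.source a * y)
    ψ (LinearMap.mul k _ ∘ₗ C.leftData.target) (LinearMap.mul k _ ∘ₗ C.leftData.source)
    (fun a y => rfl) (fun a y => rfl) (fun y => one_mul y) (fun b a => a * b)
    (fun b => one_mul b) (fun b h a => by simp [hψ, hC.leftTarget_mul, mul_assoc])
    (fun b a y => by simp [leftSource_mul, mul_assoc])
  obtain ⟨e₂, he₂⟩ := exists_equiv_balancedTensor_left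
    (p := fun (a : B) x => x * C.leftData.target a) (q := fun (a : B) y => C.leftData.target a * y)
    ψ' ((LinearMap.mul k _).flip ∘ₗ C.leftData.target) (LinearMap.mul k _ ∘ₗ C.leftData.target)
    (fun a y => rfl) (fun a y => rfl) (fun y => by simp [leftTarget_one]) (fun b a => b * a)
    (fun b => mul_one b) (fun b h a => by simp [hψ', hC.leftTarget_mul, mul_assoc])
    (fun b a y => by simp [hC.leftTarget_mul, mul_assoc])
  let τ := twistEquiv hS (Coalgebra.comul (R := k) (A := H)) Coalgebra.coassoc_apply hε
    C.leftOfAction C.leftOfAction_one C.leftOfAction_mul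
  refine ⟨e₂.symm ≪≫ₗ τ ≪≫ₗ e₁, fun X Y u hu => ?_⟩
  rw [LeftBialgebroidData.proj_mul_right (v := C.leftComulLift X) hu]
  clear hu u
  obtain ⟨x, rfl⟩ := ψ'.surjective X
  induction x with
  | zero => simp
  | add x y hx hy =>
    simp only [map_add, TensorProduct.add_tmul, Submodule.Quotient.mk_add, add_mul, hx, hy]
  | tmul h a =>
    have h1 : e₂.symm (Submodule.Quotient.mk (ψ' (h ⊗ₜ a) ⊗ₜ Y)) =
        h ⊗ₜ (C.leftData.target a * Y) := by
      refine e₂.symm_apply_eq.2 ?_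
      rw [he₂, hψ', hψ', leftTarget_one, mul_one]
      exact balanced_tmul (fun (a : B) x => x * C.leftData.target a)
        (fun (a : B) y => C.leftData.target a * y) a _ _
    have h2 : ∀ z : H ⊗[k] H, e₁ ((C.leftOfAction (C.leftData.target a * Y)).lTensor H z) =
        C.leftData.proj (TensorProduct.map C.leftOf C.leftOf z *
          ((1 ⊗ₜ C.leftData.target a) * (1 ⊗ₜ Y))) := fun z => by
      induction z with
      | zero => simp
      | add x y hx hy => simp only [map_add, add_mul, hx, hy]
      | tmul x y => simp [he₁, hψ, leftTarget_one, leftOfAction_apply]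
    have h3 : τ (h ⊗ₜ (C.leftData.target a * Y)) =
        (C.leftOfAction (C.leftData.target a * Y)).lTensor H (Coalgebra.comul (R := k) h) :=
      twist_tmul _ _ _ _
    rw [LinearEquiv.trans_apply, LinearEquiv.trans_apply, h1, h3, h2, hψ', leftComulLift_mul,
      mul_assoc, ← leftComulLift_leftOf]
    -- Replacing δ(t(a)) by 1 ⊗ t(a) is legitimate only in the quotient. To the right of δ(η(h)) it
    -- needs the Takeuchi property of δ(η(h)).
    exact LeftBialgebroidData.proj_mul_left (fun b => C.leftComulLift_leftOf_takeuchi b h)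
      (LeftBialgebroidData.proj_mul_right (C.leftComulLift_target a).symm _)

/-- Mirror image of the left Hopf case, with bases s(a) η(h) and η(h) s(a) of the second factor. The
map becomes X ⊗ h ↦ η(h₁) X ⊗ h₂, with inverse X ⊗ h ↦ η(S(h₁)) X ⊗ h₂. -/
theorem IsBraidedCommutative.isAntiLeftHopf (hC : C.IsBraidedCommutative) :
    C.leftData.IsAntiLeftHopf := by
  have hε : ∀ h : H, TensorProduct.lid k H ((Coalgebra.counit (R := k) (A := H)).rTensor H
      (Coalgebra.comul (R := k) h)) = h := fun h => by simp
  -- `h ⊗ a ↦ s(a) (1 ⊗ h)` and `h ⊗ a ↦ (1 ⊗ h) s(a)`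
  let ψ : H ⊗[k] B ≃ₗ[k] C.LeftSmash := TensorProduct.comm k H B ≪≫ₗ C.toLeft
  have hψ : ∀ h a, ψ (h ⊗ₜ a) = C.leftData.source a * C.leftOf h := fun h a => C.toLeft_tmul a h
  -- The change of basis is η(h) s(a) = s(a ◁ h₁) η(h₂); it involves the first leg of Δ(h), so it is
  -- inverted with S.
  let ψ' : H ⊗[k] B ≃ₗ[k] C.LeftSmash := TensorProduct.comm k H B ≪≫ₗ
    twistLeftEquiv Coalgebra.comul Coalgebra.coassoc_apply hε C.act C.act_one C.act_mul ≪≫ₗ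
    C.toLeft
  have hψ' : ∀ h a, ψ' (h ⊗ₜ a) = C.leftOf h * C.leftData.source a := fun h a => by
    have key : ∀ z : H ⊗[k] H, C.toLeft ((C.act a).rTensor H z) = LinearMap.mul' k _
        (TensorProduct.map (C.leftData.source ∘ₗ C.act a) C.leftOf z) := fun z => by
      induction z with
      | zero => simp
      | add x y hx hy => simp only [map_add, hx, hy]
      | tmul x y => simp [toLeft_tmul]
    rw [leftOf_mul_leftSource, ← key]
    exact congrArg C.toLeft (twistLeft_tmul _ _ h a)
  obtain ⟨e₁, he₁⟩ := exists_equiv_balancedTensor_right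
    (p := fun (a : B) x => C.leftData.target a * x) (q := fun (a : B) y => C.leftData.source a * y)
    ψ (LinearMap.mul k _ ∘ₗ C.leftData.target) (LinearMap.mul k _ ∘ₗ C.leftData.source)
    (fun a y => rfl) (fun a y => rfl) (fun y => by simp [leftTarget_one]) (fun b a => b * a)
    (fun b => mul_one b) (fun b h a => by simp [hψ, leftSource_mul, mul_assoc])
    (fun b a y => by simp [hC.leftTarget_mul, mul_assoc])
  obtain ⟨e₂, he₂⟩ := exists_equiv_balancedTensor_right
    (p := fun (a : B) x => C.leftData.source a * x) (q := fun (a : B) y => y * C.leftData.source a)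
    ψ' (LinearMap.mul k _ ∘ₗ C.leftData.source)
    ((LinearMap.mul k _).flip ∘ₗ C.leftData.source)
    (fun a y => rfl) (fun a y => rfl) (fun y => one_mul y) (fun b a => a * b)
    (fun b => one_mul b) (fun b h a => by simp [hψ', leftSource_mul, mul_assoc])
    (fun b a y => by simp [leftSource_mul, mul_assoc])
  let τ := twistLeftEquiv (Coalgebra.comul (R := k) (A := H)) Coalgebra.coassoc_apply hε
    C.leftOfAction C.leftOfAction_one C.leftOfAction_mul
  refine ⟨e₂.symm ≪≫ₗ τ ≪≫ₗ e₁, fun X Y u hu => ?_⟩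
  rw [LeftBialgebroidData.proj_mul_right (v := C.leftComulLift Y) hu]
  clear hu u
  obtain ⟨y, rfl⟩ := ψ'.surjective Y
  induction y with
  | zero => simp
  | add x y hx hy =>
    simp only [map_add, TensorProduct.tmul_add, Submodule.Quotient.mk_add, add_mul, hx, hy]
  | tmul h a =>
    have h1 : e₂.symm (Submodule.Quotient.mk (X ⊗ₜ ψ' (h ⊗ₜ a))) =
        (C.leftData.source a * X) ⊗ₜ h := by
      refine e₂.symm_apply_eq.2 ?_
      rw [he₂, hψ', hψ', leftSource_one, mul_one]
      exact (balanced_tmul (fun (a : B) x => C.leftData.source a * x)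
        (fun (a : B) y => y * C.leftData.source a) a _ _).symm
    have h2 : ∀ z : H ⊗[k] H, e₁ ((C.leftOfAction (C.leftData.source a * X)).rTensor H z) =
        C.leftData.proj (TensorProduct.map C.leftOf C.leftOf z *
          ((C.leftData.source a ⊗ₜ 1) * (X ⊗ₜ 1))) := fun z => by
      induction z with
      | zero => simp
      | add x y hx hy => simp only [map_add, add_mul, hx, hy]
      | tmul x y => simp [he₁, hψ, leftOfAction_apply]
    have h3 : τ ((C.leftData.source a * X) ⊗ₜ h) =
        (C.leftOfAction (C.leftData.source a * X)).rTensor H (Coalgebra.comul (R := k) h) :=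
      twistLeft_tmul _ _ _ _
    rw [LinearEquiv.trans_apply, LinearEquiv.trans_apply, h1, h3, h2, hψ',
      leftComulLift_leftOf_mul_source, mul_assoc, ← leftComulLift_leftOf]

end Hopf

/-! ## The involution -/

section Star

variable {H B : Type*} [Ring H] [HopfAlgebra ℂ H] [StarRing H] [StarModule ℂ H]
  [Ring B] [Algebra ℂ B] [StarRing B] [StarModule ℂ B]

theorem _root_.HopfAlgebroids.IsHopfStarAlgebra.antipodeInv_star (hH : IsHopfStarAlgebra H)
    (hS : Function.Bijective (HopfAlgebra.antipode ℂ (A := H))) (h : H) :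
    antipodeInv hS (star h) = star (HopfAlgebra.antipode ℂ h) := by
  rw [antipodeInv_eq_iff]
  simpa using (hH.antipode_star (star h)).symm

variable (C : CrossedModuleAlgebra ℂ H B)
variable (hS : Function.Bijective (HopfAlgebra.antipode ℂ (A := H)))

/-- The antilinear map `a ⊗ h ↦ S⁻¹(h*) ⊗ a*` from `B # H^op` to `H # B`. -/
def starMap : C.LeftSmash ≃ₛₗ[starRingEnd ℂ] C.RightSmash :=
  (C.toLeft.symm.trans (starLinearEquiv ℂ : B ⊗[ℂ] H ≃ₗ⋆[ℂ] B ⊗[ℂ] H)).trans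
    (TensorProduct.comm ℂ B H ≪≫ₗ
      TensorProduct.congr (LinearEquiv.ofBijective (HopfAlgebra.antipode ℂ (A := H)) hS).symm
        (LinearEquiv.refl ℂ B) ≪≫ₗ C.toRight)

theorem starMap_toLeft (a : B) (h : H) :
    C.starMap hS (C.toLeft (a ⊗ₜ h)) = C.toRight (antipodeInv hS (star h) ⊗ₜ star a) := rfl

theorem starMap_source (a : B) :
    C.starMap hS (C.leftData.source a) = (C.rightData hS).source (star a) := by
  rw [leftSource_apply, starMap_toLeft, star_one,
    (antipodeInv_eq_iff hS).2 HopfAlgebra.antipode_one.symm]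
  rfl

variable {C}

theorem IsUnitaryCoaction.starMap_target (hcoact : C.IsUnitaryCoaction) (a : B) :
    C.starMap hS (C.leftData.target a) = (C.rightData hS).target (star a) := by
  change _ = C.toRight (TensorProduct.comm ℂ B H
    ((antipodeInv hS).lTensor B (C.coact (star a))))
  rw [hcoact, leftTarget_apply]
  generalize C.coact a = z
  induction z with
  | zero => simp
  | add x y hx hy => simp only [map_add, star_add, hx, hy]
  | tmul x y => simp [starMap_toLeft]

theorem comul_star_antipode (hH : IsHopfStarAlgebra H) (h : H) :
    Coalgebra.comul (R := ℂ) (star (HopfAlgebra.antipode ℂ h)) =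
      star (TensorProduct.map (HopfAlgebra.antipode ℂ) (HopfAlgebra.antipode ℂ)
        (TensorProduct.comm ℂ H H (Coalgebra.comul (R := ℂ) h))) := by
  rw [hH.comul_star, comul_antipode]

/-- With S⁻¹(h*) = S(h)*, both sides become S(g)* S(h₂)* ⊗ (b* ◁ S(h₁)*) a*. The flip of legs in
Δ(S(h)*) = S(h₂)* ⊗ S(h₁)* matches the different leg conventions of the two smash products. -/
theorem IsUnitaryAction.starMap_mul (hact : C.IsUnitaryAction hS) (hH : IsHopfStarAlgebra H)
    (X Y : C.LeftSmash) :
    C.starMap hS (X * Y) = C.starMap hS Y * C.starMap hS X := by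
  obtain ⟨x, rfl⟩ := C.toLeft.surjective X
  obtain ⟨y, rfl⟩ := C.toLeft.surjective Y
  induction x with
  | zero => simp
  | add x y hx hy => simp only [map_add, add_mul, mul_add, hx, hy]
  | tmul a h =>
  induction y with
  | zero => simp
  | add x y hx hy => simp only [map_add, add_mul, mul_add, hx, hy]
  | tmul b g =>
  rw [toLeft_mul_toLeft, leftMul_tmul, starMap_toLeft, starMap_toLeft, toRight_mul_toRight,
    rightMul_tmul, hH.antipodeInv_star hS h, comul_star_antipode hH]
  generalize Coalgebra.comul (R := ℂ) h = z
  induction z with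
  | zero => simp
  | add x y hx hy => simp only [map_add, star_add, hx, hy]
  | tmul x y =>
    have e : antipodeInv hS (star y * star g) =
        star (HopfAlgebra.antipode ℂ g) * star (HopfAlgebra.antipode ℂ y) := by
      rw [← star_mul, hH.antipodeInv_star, HopfAlgebra.antipode_mul_antidistrib, star_mul]
    simp [starMap_toLeft, hH.antipodeInv_star, hact b x, e]

/-- `B # H^op` and `H # B` are `*`-related. -/
theorem isStarRelated (hH : IsHopfStarAlgebra H) (hact : C.IsUnitaryAction hS)
    (hcoact : C.IsUnitaryCoaction) :
    IsStarRelated C.leftData (C.rightData hS) (C.starMap hS) where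
  map_one := by
    rw [← leftSource_one, starMap_source, star_one]
    rfl
  map_mul := hact.starMap_mul hS hH
  map_source := C.starMap_source hS
  map_target := hcoact.starMap_target hS
  map_comul X u hu := by
    have hcongr := LeftBialgebroidData.proj_congr (D := C.leftData)
      (v := C.leftComulLift X) ((C.rightData hS).proj ∘ₛₗ
        ((TensorProduct.comm ℂ C.RightSmash C.RightSmash).toLinearMap ∘ₛₗ TensorProduct.map
        (C.starMap hS).toLinearMap (C.starMap hS).toLinearMap)) (fun a x y => by
          simp only [LinearMap.comp_apply, TensorProduct.map_tmul, LinearEquiv.coe_coe,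
            TensorProduct.comm_tmul, hact.starMap_mul hS hH, starMap_source,
            hcoact.starMap_target]
          exact (balanced_tmul (fun a x => x * (C.rightData hS).source a)
            (fun a y => y * (C.rightData hS).target a) (star a) _ _).symm) hu
    refine Eq.trans ?_ hcongr.symm
    -- For the lifts δ X the identity already holds in the unbalanced tensor square.
    refine congrArg (C.rightData hS).proj ?_
    clear hcongr hu
    obtain ⟨x, rfl⟩ := C.toLeft.surjective X
    induction x with
    | zero => simp
    | add x y hx hy => simp only [map_add, hx, hy]
    | tmul a h =>
    rw [starMap_toLeft, hH.antipodeInv_star]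
    simp only [rightComulLift, leftComulLift, LinearMap.comp_apply, LinearEquiv.coe_coe,
      LinearEquiv.symm_apply_apply, LinearMap.rTensor_tmul, LinearMap.lTensor_tmul,
      comul_star_antipode hH]
    generalize Coalgebra.comul (R := ℂ) h = z
    induction z with
    | zero => simp
    | add x y hx hy =>
      simp only [map_add, star_add, TensorProduct.add_tmul, TensorProduct.tmul_add, hx, hy]
    | tmul x y => simp [starMap_toLeft, hH.antipodeInv_star]
  map_counit X := by
    obtain ⟨x, rfl⟩ := C.toLeft.surjective X
    induction x with
    | zero => simp
    | add x y hx hy => simp only [map_add, star_add, hx, hy]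
    | tmul a h =>
      rw [starMap_toLeft, hH.antipodeInv_star]
      simp [rightData, leftData, hH.counit_star, star_smul]

/-- The claim is equivalent to T² = 1 for T = σ Φ⁻¹. As a composite of two product-reversing maps T
is multiplicative, and it interchanges source and target up to the involution of B, so T² = 1 can be
tested on the elements h ⊗ 1 and 1 ⊗ a. -/
theorem reflexiveMap_symm_starMap (hH : IsHopfStarAlgebra H) (hC : C.IsBraidedCommutative)
    (hact : C.IsUnitaryAction hS) (hcoact : C.IsUnitaryCoaction) (X : C.LeftSmash) :
    (C.reflexiveMap hS).symm (C.starMap hS X) = (C.starMap hS).symm (C.reflexiveMap hS X) := by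
  let T : C.RightSmash → C.RightSmash := fun Z => C.starMap hS ((C.reflexiveMap hS).symm Z)
  have T_mul : ∀ Z W, T (Z * W) = T Z * T W := fun Z W => by
    simp only [T, hC.reflexiveMap_symm_mul, hact.starMap_mul hS hH]
  have T_of : ∀ h, T (C.toRight (h ⊗ₜ 1)) = C.toRight (antipodeInv hS (star h) ⊗ₜ 1) :=
    fun h => by
    simp only [T]
    rw [← C.reflexiveMap_leftOf hS, LinearEquiv.symm_apply_apply, leftOf_apply, starMap_toLeft,
      star_one]
  have T_source : ∀ a, T ((C.rightData hS).source a) = (C.rightData hS).target (star a) :=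
    fun a => by
    simp only [T]
    rw [← reflexiveMap_target, LinearEquiv.symm_apply_apply, hcoact.starMap_target]
  have T_target : ∀ a, T ((C.rightData hS).target a) = (C.rightData hS).source (star a) :=
    fun a => by
    simp only [T]
    rw [← reflexiveMap_source, LinearEquiv.symm_apply_apply, starMap_source]
  have T_T : ∀ Z, T (T Z) = Z := fun Z => by
    obtain ⟨z, rfl⟩ := C.toRight.surjective Z
    induction z with
    | zero => simp [T]
    | add x y hx hy =>
      simp only [T] at hx hy ⊢
      simp only [map_add, hx, hy]
    | tmul h a =>
      rw [C.toRight_tmul hS, T_mul, T_mul, T_of, T_of, T_source, T_target, star_star,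
        hH.antipodeInv_star, antipode_antipodeInv, star_star]
  have := T_T (C.reflexiveMap hS X)
  simp only [T, LinearEquiv.symm_apply_apply] at this
  rw [← this, LinearEquiv.symm_apply_apply]

end Star

end CrossedModuleAlgebra

end HopfAlgebroids

end

open HopfAlgebroids
theorem theorem4p9 {H B : Type*} [Ring H] [HopfAlgebra ℂ H] [StarRing H] [StarModule ℂ H]
    [Ring B] [Algebra ℂ B] [StarRing B] [StarModule ℂ B]
    (hH : IsHopfStarAlgebra H)
    (hS : Function.Bijective (HopfAlgebra.antipode ℂ (A := H)))
    (C : CrossedModuleAlgebra ℂ H B)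
    (hC : C.IsBraidedCommutative)
    (hact : C.IsUnitaryAction hS)
    (hcoact : C.IsUnitaryCoaction) :
    ∃ (σ : C.LeftSmash ≃ₛₗ[starRingEnd ℂ] C.RightSmash) (Φ : C.LeftSmash ≃ₗ[ℂ] C.RightSmash),
      (∀ (a : B) (h : H),
        σ (C.toLeft (a ⊗ₜ h)) = C.toRight (antipodeInv hS (star h) ⊗ₜ star a)) ∧
      (∀ (a : B) (h : H),
        Φ (C.toLeft (a ⊗ₜ h)) = C.toRight (TensorProduct.comm ℂ B H
          ((LinearMap.mulLeft ℂ h ∘ₗ antipodeInv hS).lTensor B (C.coact a)))) ∧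
      (∀ (h : H) (a : B),
        Φ.symm (C.toRight (h ⊗ₜ a)) =
          C.toLeft ((LinearMap.mulLeft ℂ h).lTensor B (C.coact a))) ∧
      IsStarHopfAlgebroidPair C.leftData (C.rightData hS) σ Φ := by
  have hΦ := hC.isReflexive hS
  have hL := hC.isLeftBialgebroid
  exact ⟨C.starMap hS, C.reflexiveMap hS, C.starMap_toLeft hS, C.reflexiveMap_toLeft hS,
    C.reflexiveMap_symm_toRight hS,
    { isLeftBialgebroid := hL
      isRightBialgebroid := hΦ.isRightBialgebroid hL
      isStarRelated := CrossedModuleAlgebra.isStarRelated hS hH hact hcoact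
      isReflexive := hΦ
      compatible := CrossedModuleAlgebra.reflexiveMap_symm_starMap hS hH hC hact hcoact
      isLeftHopf := hC.isLeftHopf hS
      isAntiLeftHopf := hC.isAntiLeftHopf
      -- Φ preserves the order of coproduct factors but reverses products, so the plain and the anti
      -- Hopf conditions are interchanged.
      isRightHopf := hΦ.isRightHopf hC.isAntiLeftHopf
      isAntiRightHopf := hΦ.isAntiRightHopf (hC.isLeftHopf hS) }⟩
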